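/- Let $T$ be a complete first-order theory in a one-sorted language, let $|T|$ denote the number of formulas of the language (the maximum of $\aleph_0$ and the number of symbols), and let $\kappa>|T|$ be a strong limit cardinal. Let $\mathfrak C$ be a monster model of $T$ with degree of saturation $\kappa$: $\mathfrak C$ is $\kappa$-saturated (every complete type in finitely many variables over a subset of $\mathfrak C$ of size less than $\kappa$ is realized in $\mathfrak C$) and strongly $\kappa$-homogeneous (every elementary map between subsets of $\mathfrak C$ of size less than $\kappa$ extends to an automorphism of $\mathfrak C$). Let $\bar c$ be an enumeration of $\mathfrak C$ (possibly with repetitions), and let $S_{\bar c}(\mathfrak C)$ be the space of all complete types over $\mathfrak C$ that extend $\operatorname{tp}(\bar c/\emptyset)$, with the Stone topology. The group $\operatorname{Aut}(\mathfrak C)$ acts on $S_{\bar c}(\mathfrak C)$ by $\sigma(q)=\{\varphi(\bar x,\sigma(a)) : \varphi(\bar x,a)\in q\}$, and it is regarded as a subset of $S_{\bar c}(\mathfrak C)$ through the map $\sigma\mapsto\operatorname{tp}(\sigma(\bar c)/\mathfrak C)$. Then the following are equivalent: 1. There is an associative binary operation $*$ on $S_{\bar c}(\mathfrak C)$ such that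 for every $q\in S_{\bar c}(\mathfrak C)$ the map $p\mapsto p*q$ is continuous, and such that $\operatorname{tp}(\sigma(\bar c)/\mathfrak C)*q=\sigma(q)$ for all $\sigma\in\operatorname{Aut}(\mathfrak C)$ and $q\in S_{\bar c}(\mathfrak C)$. 2. $T$ is stable, that is, there is a cardinal $\mu\ge|T|$ such that for every model $M$ of $T$ with $|M|\le\mu$ there are at most $\mu$ complete $1$-types over $M$. -/

import Mathlib

open FirstOrder FirstOrder.Language Cardinal

universe u v w x

namespace GlobalTypes

/-! ### Monster models -/

section Monster

variable (L : FirstOrder.Language.{u, v}) (C : Type w) [L.Structure C]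

/-- `C` is `κ`-saturated: for every parameter set `A ⊆ C` with fewer than `κ` elements, every
complete `n`-type over `A` is realized in `C`. -/
def IsSaturated [Nonempty C] (κ : Cardinal.{w}) : Prop :=
  ∀ A : Set C, #A < κ → ∀ (n : ℕ) (p : (L[[A]].completeTheory C).CompleteType (Fin n)),
    p ∈ (L[[A]].completeTheory C).realizedTypes C (Fin n)

/-- `C` is strongly `κ`-homogeneous: every elementary map `f : A → C` (equivalently, between
subsets of `C`) whose domain `A ⊆ C` has fewer than `κ` elements extends to an automorphism. -/
def IsStronglyHomogeneous (κ : Cardinal.{w}) : Prop :=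
  ∀ A : Set C, #A < κ → ∀ f : A → C,
    (∀ φ : L.Formula A, φ.Realize f ↔ φ.Realize (fun a : A => (a : C))) →
      ∃ σ : C ≃[L] C, ∀ a : A, σ a = f a

/-- `C` is a monster model with degree of saturation `κ`: here `κ` is a strong limit cardinal
greater than `|T|`, the number of formulas of the language, that is the maximum of `ℵ₀` and the
number of symbols. -/
structure IsMonster [Nonempty C] (κ : Cardinal.{w}) : Prop where
  strongLimit : κ.IsStrongLimit
  card_lt : Cardinal.lift.{w} (max ℵ₀ L.card) < Cardinal.lift.{max u v} κ
  saturated : IsSaturated L C κ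
  homogeneous : IsStronglyHomogeneous L C κ

end Monster

/-! ### Stability -/

/-- `T` is `μ`-stable: over every model `M` of `T` of cardinality at most `μ` there are at most
`μ` complete `1`-types. -/
def IsStableIn {L : FirstOrder.Language.{u, v}} (T : L.Theory) (μ : Cardinal.{max u v}) : Prop :=
  ∀ (M : Type (max u v)) [L.Structure M] [Nonempty M] [M ⊨ T], #M ≤ μ →
    #((L.elementaryDiagram M).CompleteType (Fin 1)) ≤ μ

/-- `T` is stable: it is `μ`-stable for some infinite cardinal `μ ≥ |T|`. -/
def IsStable {L : FirstOrder.Language.{u, v}} (T : L.Theory) : Prop :=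
  ∃ μ : Cardinal.{max u v}, max ℵ₀ L.card ≤ μ ∧ IsStableIn T μ

/-! ### The space `S_c(C)` and the action of the automorphism group -/

section TypeSpace

variable (L : FirstOrder.Language.{u, v}) {C : Type w} {ι : Type x}

/-- The language map replacing every parameter `a` by `f a` (and fixing the variables `ι`). -/
abbrev paramMap (ι : Type x) (f : C → C) : L[[C]][[ι]] →ᴸ L[[C]][[ι]] :=
  (L.lhomWithConstantsMap f).addConstants ι

/-- A formula without parameters, in the variables `ι`, seen as a formula over `C` (complete types
in the variables `ι` are made of sentences in which the variables are new constants). -/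
def parameterFree (C : Type w) (φ : L.Formula ι) : L[[C]][[ι]].Sentence :=
  ((L.lhomWithConstants C).addConstants ι).onSentence (Formula.equivSentence φ)

theorem paramMap_onSentence_lhom (f : C → C) (ψ : L[[C]].Sentence) :
    (paramMap L ι f).onSentence ((L[[C]].lhomWithConstants ι).onSentence ψ) =
      (L[[C]].lhomWithConstants ι).onSentence ((L.lhomWithConstantsMap f).onSentence ψ) := by
  have h : (paramMap L ι f).comp (L[[C]].lhomWithConstants ι) =
      (L[[C]].lhomWithConstants ι).comp (L.lhomWithConstantsMap f) := by ext <;> rfl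
  have := congrArg (fun g => LHom.onBoundedFormula g ψ) h
  simp only [LHom.comp_onBoundedFormula] at this
  exact this

theorem paramMap_parameterFree (f : C → C) (φ : L.Formula ι) :
    (paramMap L ι f).onSentence (parameterFree L C φ) = parameterFree L C φ := by
  have h : (paramMap L ι f).comp ((L.lhomWithConstants C).addConstants ι) =
      (L.lhomWithConstants C).addConstants ι := by
    ext n s
    · rcases s with s | s <;> rfl
    · rcases s with s | s <;> rfl
  have := congrArg (fun g => LHom.onBoundedFormula g (Formula.equivSentence φ)) h
  simp only [LHom.comp_onBoundedFormula] at this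
  exact this

variable [L.Structure C]

/-- `S_c(C)`: the complete types over `C` in the variables `ι` that extend `tp(c/∅)`, with the
subspace topology of the Stone topology on the space of complete types over `C`. -/
def typeSpace (c : ι → C) : Set ((L.elementaryDiagram C).CompleteType ι) :=
  {p | ∀ φ : L.Formula ι, parameterFree L C φ ∈ p ↔ φ.Realize c}

variable {L}

theorem realize_map_iff (σ : C ≃[L] C) (ψ : L[[C]].Sentence) :
    C ⊨ (L.lhomWithConstantsMap (σ : C → C)).onSentence ψ ↔ C ⊨ ψ := by
  have h1 : C ⊨ (L.lhomWithConstantsMap (σ : C → C)).onSentence ψ ↔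
      (Formula.equivSentence.symm ψ).Realize (σ : C → C) := by
    rw [Formula.realize_equivSentence_symm]
    let _ : (constantsOn C).Structure C := constantsOn.structure (σ : C → C)
    let S' : L[[C]].Structure C := FirstOrder.Language.withConstantsStructure L C
    have hexp : @LHom.IsExpansionOn _ _ (L.lhomWithConstantsMap (σ : C → C)) C S'
        (withConstantsSelfStructure L) := by
      refine @LHom.IsExpansionOn.mk _ _ _ _ S' (withConstantsSelfStructure L) ?_ ?_
      · rintro n (f | f) xs
        · rfl
        · cases n with
          | zero => rfl
          | succ n => exact isEmptyElim f
      · rintro n (R | R) xs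
        · rfl
        · exact isEmptyElim R
    exact @LHom.realize_onSentence L[[C]] L[[C]] C S' (withConstantsSelfStructure L)
      (L.lhomWithConstantsMap (σ : C → C)) hexp ψ
  have h2 : C ⊨ ψ ↔ (Formula.equivSentence.symm ψ).Realize (id : C → C) := by
    rw [Formula.realize_equivSentence_symm]
  rw [h1, h2]
  exact StrongHomClass.realize_formula (v := id) σ (Formula.equivSentence.symm ψ)

/-- The action of an automorphism on complete types over `C`:
`σ(p) = {φ(x, σ(a)) : φ(x, a) ∈ p}`, that is, `φ(x, a) ∈ σ(p) ↔ φ(x, σ⁻¹(a)) ∈ p`. -/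
def autAct [Nonempty C] (σ : C ≃[L] C) (p : (L.elementaryDiagram C).CompleteType ι) :
    (L.elementaryDiagram C).CompleteType ι where
  toTheory := {φ | (paramMap L ι (σ.symm : C → C)).onSentence φ ∈ p}
  subset' := by
    rintro _ ⟨ψ, hψ, rfl⟩
    refine p.subset ?_
    rw [paramMap_onSentence_lhom L]
    exact ⟨_, (realize_map_iff σ.symm ψ).2 hψ, rfl⟩
  isMaximal' := by
    constructor
    · refine Theory.isSatisfiable_of_isSatisfiable_onTheory
        (paramMap L ι (σ.symm : C → C)) (p.isMaximal.1.mono ?_)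
      rintro _ ⟨φ, hφ, rfl⟩
      exact hφ
    · intro φ
      exact p.mem_or_not_mem _

/-- The action of the automorphism group on `S_c(C)`. -/
def autActOn [Nonempty C] (c : ι → C) (σ : C ≃[L] C) (q : typeSpace L c) : typeSpace L c :=
  ⟨autAct σ q.1, fun φ => by
    rw [← q.2 φ, ← SetLike.mem_coe]
    change (paramMap L ι (σ.symm : C → C)).onSentence (parameterFree L C φ) ∈ q.1 ↔ _
    rw [paramMap_parameterFree L]⟩

theorem parameterFree_mem_typeOf [Nonempty C] (d : ι → C) (φ : L.Formula ι) :
    parameterFree L C φ ∈ (L.elementaryDiagram C).typeOf d ↔ φ.Realize d := by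
  let _ : (constantsOn ι).Structure C := constantsOn.structure d
  change C ⊨ ((L.lhomWithConstants C).addConstants ι).onSentence (Formula.equivSentence φ) ↔ _
  rw [LHom.realize_onSentence]
  exact Formula.realize_equivSentence C φ

/-- The map `σ ↦ tp(σ(c)/C)` from the automorphism group to `S_c(C)`. -/
def autType [Nonempty C] (c : ι → C) (σ : C ≃[L] C) : typeSpace L c :=
  ⟨(L.elementaryDiagram C).typeOf (fun i => σ (c i)), fun φ => by
    rw [parameterFree_mem_typeOf]
    exact StrongHomClass.realize_formula (v := c) σ φ⟩

end TypeSpace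

end GlobalTypes

/-!
The existence of the operation and stability are both equivalent to the absence of a formula with
the order property in `C` (`HasOrderFormula`), a first-order condition on `T`.

*No order property implies a semigroup operation* (`exists_semigroup_operation`). The automorphism
group is dense in the type space, so `p * q` has to be the limit of `σ(q)` for `tp(σ(c)/C)` tending
to `p`, and what must be shown is that these limits exist. By the Erdős–Makkai argument
(`exists_finset_of_not_hasOrderProperty`), a limit of sections of a relation without the order
property is a Boolean combination of finitely many of them. Applied to the relation
`φ(x, σ⁻¹(a))` between tuples `x` and automorphisms `σ`, this says that whether `φ(x, a) ∈ σ(q)`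
depends only on finitely many formulas true of `σ(c)`. Associativity follows by density.

*A semigroup operation implies no order property* (`not_hasOrderFormula_of_operation`). An ordered
sequence yields, by compactness and saturation, an infinite ordered sequence of constant type, and
hence two sequences of automorphisms whose limits are taken in opposite orders by `p * q` and by
continuity in `p`; the two iterated limits disagree.

*No order property implies stability* (`isStable_of_not_hasOrderFormula`). By the Erdős–Makkai
argument a type over `M` is determined by finitely many elements for each formula without
parameters, so that `2 ^ |T|` is a cardinal in which `T` is stable.

*The order property contradicts stability* (`not_isStable_of_hasOrderFormula`). An ordered family
indexed by a linear order of size greater than `μ`, with a separating subset of size at most `μ`,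
gives more than `μ` types of finite tuples over `μ` parameters, while stability in one variable
bounds the number of types in several variables (`IsStableIn.mk_le`). Ultrapowers replace monster
models here, since `μ` need not be related to `κ`.
-/

/-! ### The order property of a relation -/

section Combinatorics

variable {X Y : Type*}

/-- A relation has the order property if it orders arbitrarily long finite sequences: for every
`N` there are `x₀, …, x_{N-1}` and `y₀, …, y_{N-1}` with `R xᵢ yⱼ ↔ i < j`. -/
def HasOrderProperty (R : X → Y → Prop) : Prop :=
  ∀ N : ℕ, ∃ (a : ℕ → X) (b : ℕ → Y), ∀ i < N, ∀ j < N, (R (a i) (b j) ↔ i < j)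

theorem HasOrderProperty.of_lt_iff {R : X → Y → Prop} {a : ℕ → X} {b : ℕ → Y}
    (h : ∀ i j, R (a i) (b j) ↔ i < j) : HasOrderProperty R :=
  fun _ => ⟨a, b, fun i _ j _ => h i j⟩

theorem HasOrderProperty.of_gt_iff {R : X → Y → Prop} {a : ℕ → X} {b : ℕ → Y}
    (h : ∀ i j, R (a i) (b j) ↔ j < i) : HasOrderProperty R := by
  intro N
  refine ⟨fun i => a (N - 1 - i), fun j => b (N - 1 - j), fun i hi j hj => ?_⟩
  rw [h]
  omega

/-- The Erdős–Makkai argument: if `R` does not have the order property, then a limit `q` of the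
sections `R x` is a Boolean combination of finitely many of them. Otherwise, for every finite set of
sections there are `y` and `y'` which it does not separate but `q` does; these witnesses and points
`x` approximating `q`, chosen in turn, are ordered by `R`. -/
theorem exists_finset_of_not_hasOrderProperty {R : X → Y → Prop} (hR : ¬ HasOrderProperty R)
    {q : Y → Prop} (hq : ∀ B : Finset Y, ∃ x, ∀ y ∈ B, (R x y ↔ q y)) :
    ∃ E : Finset X, ∀ y y', (∀ x ∈ E, (R x y ↔ R x y')) → (q y ↔ q y') := by
  classical
  by_contra! hcon
  have hcon' : ∀ E : Finset X, ∃ y y', (∀ x ∈ E, (R x y ↔ R x y')) ∧ q y ∧ ¬ q y' := by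
    intro E
    obtain ⟨y, y', h, h'⟩ := hcon E
    by_cases hy : q y
    · exact ⟨y, y', h, hy, by tauto⟩
    · exact ⟨y', y, fun x hx => (h x hx).symm, by tauto, hy⟩
  choose y y' hyy hy hy' using hcon'
  let U : Ultrafilter (Finset X) := Ultrafilter.of Filter.atTop
  -- `t x` is the common limit of `R x (y E)` and `R x (y' E)`.
  let t : X → Prop := fun x => ∀ᶠ E in (U : Filter (Finset X)), R x (y E)
  have hmem : ∀ x, ∀ᶠ E in (U : Filter (Finset X)), x ∈ E := fun x =>
    Filter.Eventually.filter_mono (Ultrafilter.of_le _)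
      ((Filter.eventually_ge_atTop {x}).mono fun E hE => hE (Finset.mem_singleton_self x))
  have ht : ∀ x, ∀ᶠ E in (U : Filter (Finset X)), ((R x (y E) ↔ t x) ∧ (R x (y' E) ↔ t x)) := by
    intro x
    have h1 : ∀ᶠ E in (U : Filter (Finset X)), (R x (y E) ↔ t x) := by
      by_cases h : t x
      · have h2 : ∀ᶠ E in (U : Filter (Finset X)), R x (y E) := h
        filter_upwards [h2] with E hE
        tauto
      · have h2 : ∀ᶠ E in (U : Filter (Finset X)), ¬ R x (y E) := Ultrafilter.eventually_not.2 h
        filter_upwards [h2] with E hE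
        tauto
    filter_upwards [h1, hmem x] with E h2 h3
    exact ⟨h2, (hyy E x h3).symm.trans h2⟩
  let P : X × Y × Y → Prop := fun d =>
    q d.2.1 ∧ ¬ q d.2.2 ∧ (R d.1 d.2.1 ↔ t d.1) ∧ (R d.1 d.2.2 ↔ t d.1)
  let r : X × Y × Y → X × Y × Y → Prop := fun d e =>
    (R e.1 d.2.1 ∧ ¬ R e.1 d.2.2) ∧ (R d.1 e.2.1 ↔ t d.1) ∧ (R d.1 e.2.2 ↔ t d.1)
  obtain ⟨f, hf, hr⟩ := exists_seq_of_forall_finset_exists P r (by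
    intro s hs
    obtain ⟨x, hx⟩ := hq (s.image (fun d => d.2.1) ∪ s.image (fun d => d.2.2))
    have h1 : ∀ᶠ E in (U : Filter (Finset X)),
        ∀ z ∈ insert x (s.image Prod.fst), ((R z (y E) ↔ t z) ∧ (R z (y' E) ↔ t z)) :=
      (Filter.eventually_all_finset _).2 fun z _ => ht z
    obtain ⟨E, hE⟩ := h1.exists
    refine ⟨(x, y E, y' E), ⟨hy E, hy' E, (hE x (by simp)).1, (hE x (by simp)).2⟩, ?_⟩
    intro d hd
    have hd1 := hx d.2.1 (Finset.mem_union_left _ (Finset.mem_image_of_mem _ hd))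
    have hd2 := hx d.2.2 (Finset.mem_union_right _ (Finset.mem_image_of_mem _ hd))
    have hd3 := hE d.1 (Finset.mem_insert_of_mem (Finset.mem_image_of_mem _ hd))
    exact ⟨⟨hd1.2 (hs d hd).1, fun h => (hs d hd).2.1 (hd2.1 h)⟩, hd3⟩)
  have hlow : ∀ i n, i < n → (R (f n).1 (f i).2.1 ∧ ¬ R (f n).1 (f i).2.2) :=
    fun i n hin => (hr i n hin).1
  have hhigh : ∀ i n, n ≤ i →
      ((R (f n).1 (f i).2.1 ↔ t (f n).1) ∧ (R (f n).1 (f i).2.2 ↔ t (f n).1)) := by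
    intro i n hin
    rcases hin.eq_or_lt with rfl | h
    · exact (hf n).2.2
    · exact (hr n i h).2
  -- For `n ≤ i` the truth value of `R xₙ yᵢ` and `R xₙ y'ᵢ` is `t xₙ`: pass to a subsequence on
  -- which it is constant.
  by_cases hinf : ∃ᶠ n in Filter.atTop, t (f n).1
  · obtain ⟨g, hg, hgt⟩ := Filter.extraction_of_frequently_atTop hinf
    refine hR (HasOrderProperty.of_lt_iff
      (a := fun i => (f (g (i + 1))).1) (b := fun j => (f (g j)).2.2) fun i j => ?_)
    rcases lt_or_ge i j with h | h
    · refine iff_of_true ((hhigh _ _ ?_).2.2 (hgt _)) h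
      exact hg.monotone h
    · refine iff_of_false (hlow _ _ (hg ?_)).2 (by omega)
      omega
  · obtain ⟨g, hg, hgt⟩ := Filter.extraction_of_frequently_atTop
      (P := fun n => ¬ t (f n).1) (Filter.not_frequently.1 hinf).frequently
    refine hR (HasOrderProperty.of_gt_iff
      (a := fun i => (f (g i)).1) (b := fun j => (f (g j)).2.1) fun i j => ?_)
    rcases lt_or_ge j i with h | h
    · exact iff_of_true (hlow _ _ (hg h)).1 h
    · exact iff_of_false (fun h' => hgt _ ((hhigh _ _ (hg.monotone h)).1.1 h')) (by omega)

end Combinatorics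

/-! ### Formulas, sentences with constants, and finitely many variables -/

namespace FirstOrder.Language

section Formulas

variable {L : FirstOrder.Language.{u, v}}

theorem Formula.realize_restrictFreeVar {α β M : Type*} [L.Structure M] [DecidableEq α]
    {φ : L.Formula α} {f : φ.freeVarFinset → β} {v : β → M} {v' : α → M}
    (h : ∀ a, v (f a) = v' a) :
    Formula.Realize (φ.restrictFreeVar f : L.Formula β) v ↔ φ.Realize v' :=
  BoundedFormula.realize_restrictFreeVar v' h

/-- Sentences in the language with constants for the parameters `A` and for the variables `α` are
formulas in the variables `A ⊕ α`. -/
def sentenceEquivFormula (L : FirstOrder.Language.{u, v}) (A : Type*) (α : Type*) :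
    L[[A]][[α]].Sentence ≃ L.Formula (A ⊕ α) :=
  Formula.equivSentence.symm.trans BoundedFormula.constantsVarsEquiv

theorem mem_typeOf_iff {M : Type*} [L.Structure M] [Nonempty M] {A : Type*} {α : Type*}
    [L[[A]].Structure M] [(L.lhomWithConstants A).IsExpansionOn M] (T : L[[A]].Theory) [M ⊨ T]
    (φ : L[[A]][[α]].Sentence) (v : α → M) :
    φ ∈ T.typeOf v ↔
      (sentenceEquivFormula L A α φ).Realize
        (Sum.elim (fun a => ((L.con a : L[[A]].Constants) : M)) v) := by
  rw [Theory.CompleteType.mem_typeOf]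
  exact (BoundedFormula.realize_constantsVarsEquiv (L := L) (M := M)
    (φ := Formula.equivSentence.symm φ)).symm

theorem mem_typeOf_completeTheory_iff {M : Type*} [L.Structure M] [Nonempty M] {A : Set M}
    {α : Type*} (φ : L[[A]][[α]].Sentence) (v : α → M) :
    φ ∈ (L[[A]].completeTheory M).typeOf v ↔
      (sentenceEquivFormula L A α φ).Realize (Sum.elim (fun a : A => (a : M)) v) := by
  rw [mem_typeOf_iff]
  rfl

theorem mem_typeOf_elementaryDiagram_iff {M : Type*} [L.Structure M] [Nonempty M]
    {α : Type*} (φ : L[[M]][[α]].Sentence) (v : α → M) :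
    φ ∈ (L.elementaryDiagram M).typeOf v ↔
      (sentenceEquivFormula L M α φ).Realize (Sum.elim id v) := by
  rw [mem_typeOf_iff]
  rfl

theorem Theory.CompleteType.exists_mem_typeOf_iff {T : L.Theory} {α M : Type*} [DecidableEq α]
    [L.Structure M] [Nonempty M] [M ⊨ T] (φ : L[[α]].Sentence) :
    (∃ v : α → M, φ ∈ T.typeOf v) ↔ (Formula.equivSentence.symm φ).exClosure.Realize M := by
  rw [← Formula.exists_realize_equivSentence_iff_realize_exClosure]
  refine exists_congr fun v => ?_
  rw [Theory.CompleteType.mem_typeOf, Formula.realize_equivSentence_symm]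
  exact iff_of_eq (congrArg _ (Formula.equivSentence.apply_symm_apply φ).symm)

/-- In a complete theory, the types realized in a given model are dense. -/
theorem Theory.CompleteType.exists_mem_typeOf {T : L.Theory} (hT : T.IsComplete) (M : Type*)
    [L.Structure M] [Nonempty M] [M ⊨ T] {α : Type*} (p : T.CompleteType α)
    {φ : L[[α]].Sentence} (hφ : φ ∈ p) : ∃ v : α → M, φ ∈ T.typeOf v := by
  classical
  obtain ⟨N, v, rfl⟩ := T.exists_modelType_is_realized_in p
  rw [exists_mem_typeOf_iff, hT.realize_sentence_iff _ M, ← hT.realize_sentence_iff _ N,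
    ← exists_mem_typeOf_iff (T := T)]
  exact ⟨v, hφ⟩

end Formulas

/-! ### The order property of a structure -/

section Unstable

variable (L : FirstOrder.Language.{u, v})

/-- Some formula, in two finite tuples of variables, has the order property in `M`. -/
def HasOrderFormula (M : Type*) [L.Structure M] : Prop :=
  ∃ (n : ℕ) (φ : L.Formula (Fin n ⊕ Fin n)),
    HasOrderProperty fun (a b : Fin n → M) => φ.Realize (Sum.elim a b)

variable {L}

theorem HasOrderFormula.of_formula {M : Type*} [L.Structure M] {α β : Type*}
    (φ : L.Formula (α ⊕ β))
    (h : HasOrderProperty fun (a : α → M) (b : β → M) => φ.Realize (Sum.elim a b)) :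
    L.HasOrderFormula M := by
  classical
  let e := φ.freeVarFinset.equivFin
  let f : φ.freeVarFinset → Fin φ.freeVarFinset.card ⊕ Fin φ.freeVarFinset.card := fun s =>
    Sum.map (fun _ => e s) (fun _ => e s) s.1
  refine ⟨φ.freeVarFinset.card, φ.restrictFreeVar f, fun N => ?_⟩
  obtain ⟨a, b, hab⟩ := h N
  -- Variables of the wrong sort do not occur: they may take any value.
  let a' : ℕ → Fin φ.freeVarFinset.card → M := fun i k =>
    Sum.elim (a i) (b i) (e.symm k).1
  let b' : ℕ → Fin φ.freeVarFinset.card → M := fun i k =>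
    Sum.elim (a i) (b i) (e.symm k).1
  refine ⟨a', b', fun i hi j hj => ?_⟩
  rw [← hab i hi j hj]
  refine Formula.realize_restrictFreeVar ?_
  rintro ⟨s | s, hs⟩ <;> simp [f, a', b']

/-- The sentence expressing that `φ` orders some sequences of length `k`. -/
noncomputable def orderSentence {n : ℕ} (φ : L.Formula (Fin n ⊕ Fin n)) (k : ℕ) : L.Sentence :=
  Formula.iExs (Fin k × (Fin n ⊕ Fin n)) (Formula.iInf fun ij : Fin k × Fin k =>
    let ψ : L.Formula (Empty ⊕ (Fin k × (Fin n ⊕ Fin n))) :=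
      φ.relabel (Sum.elim (fun s => Sum.inr (ij.1, Sum.inl s)) (fun s => Sum.inr (ij.2, Sum.inr s)))
    if ij.1 < ij.2 then ψ else ψ.not)

theorem realize_orderSentence {n : ℕ} (φ : L.Formula (Fin n ⊕ Fin n)) (k : ℕ) (M : Type*)
    [L.Structure M] : M ⊨ orderSentence φ k ↔ ∃ d : Fin k × (Fin n ⊕ Fin n) → M,
      ∀ i j : Fin k, (φ.Realize (Sum.elim (fun s => d (i, Sum.inl s))
        (fun s => d (j, Sum.inr s))) ↔ i < j) := by
  refine (Formula.realize_iExs).trans (exists_congr fun d => ?_)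
  rw [Formula.realize_iInf, Prod.forall]
  refine forall_congr' fun i => forall_congr' fun j => ?_
  let ψ : L.Formula (Empty ⊕ (Fin k × (Fin n ⊕ Fin n))) :=
    φ.relabel (Sum.elim (fun s => Sum.inr (i, Sum.inl s)) (fun s => Sum.inr (j, Sum.inr s)))
  have : ψ.Realize (Sum.elim (default : Empty → M) d) ↔
      φ.Realize (Sum.elim (fun s => d (i, Sum.inl s)) (fun s => d (j, Sum.inr s))) := by
    rw [Formula.realize_relabel]
    refine iff_of_eq (congrArg _ ?_)
    ext (s | s) <;> rfl
  rw [← this]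
  by_cases hij : i < j
  · simp only [hij, if_true, iff_true, ψ]
  · simp only [hij, if_false, iff_false, Formula.realize_not, ψ]

theorem HasOrderFormula.of_isComplete {T : L.Theory} (hT : T.IsComplete) {M N : Type*}
    [L.Structure M] [Nonempty M] [M ⊨ T] [L.Structure N] [Nonempty N] [N ⊨ T]
    (h : L.HasOrderFormula M) : L.HasOrderFormula N := by
  obtain ⟨n, φ, h⟩ := h
  refine ⟨n, φ, fun k => ?_⟩
  have hM : M ⊨ orderSentence φ k := by
    rw [realize_orderSentence]
    obtain ⟨a, b, hab⟩ := h k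
    exact ⟨fun s => Sum.elim (a s.1) (b s.1) s.2, fun i j => hab i i.2 j j.2⟩
  rw [hT.realize_sentence_iff _ M, ← hT.realize_sentence_iff _ N, realize_orderSentence] at hM
  obtain ⟨d, hd⟩ := hM
  rcases Nat.eq_zero_or_pos k with rfl | hk
  · exact ⟨fun _ => Classical.arbitrary _, fun _ => Classical.arbitrary _, fun i hi => by omega⟩
  let c : ℕ → Fin k := fun i => if h : i < k then ⟨i, h⟩ else ⟨0, hk⟩
  refine ⟨fun i s => d (c i, Sum.inl s), fun j s => d (c j, Sum.inr s), fun i hi j hj => ?_⟩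
  refine (hd (c i) (c j)).trans ?_
  simp [c, hi, hj]

end Unstable

end FirstOrder.Language

/-! ### Realizing filters in saturated and homogeneous structures -/

theorem Filter.iInf_principal_neBot {X J : Type*} [Nonempty J] (s : J → Set X)
    (hs : ∀ i, (s i).Nonempty) (hd : ∀ i j, ∃ k, s k ⊆ s i ∧ s k ⊆ s j) :
    (⨅ i, Filter.principal (s i)).NeBot := by
  have : Nonempty X := (hs (Classical.arbitrary J)).to_type
  refine Filter.iInf_neBot_of_directed (fun i j => ?_) fun i => Filter.principal_neBot_iff.2 (hs i)
  obtain ⟨k, h⟩ := hd i j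
  exact ⟨k, Filter.principal_mono.2 h.1, Filter.principal_mono.2 h.2⟩

theorem Filter.eventually_mem_iInf_principal {X J : Type*} (s : J → Set X) (i : J) :
    ∀ᶠ x in ⨅ i, Filter.principal (s i), x ∈ s i :=
  Filter.mem_iInf_of_mem i (Filter.mem_principal_self _)

theorem FirstOrder.Language.Theory.CompleteType.eventually_mem_iff_of_tendsto
    {L : FirstOrder.Language.{u, v}} {T : L.Theory} {α J : Type*} {F : Filter J}
    {f : J → T.CompleteType α} {p : T.CompleteType α} (h : Filter.Tendsto f F (nhds p))
    (φ : L[[α]].Sentence) : ∀ᶠ j in F, (φ ∈ f j ↔ φ ∈ p) := by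
  by_cases hp : φ ∈ p
  · filter_upwards [h.eventually ((CompleteType.isOpen_typesWith φ).mem_nhds hp)] with j hj
    exact iff_of_true hj hp
  · filter_upwards [h.eventually ((CompleteType.isClosed_typesWith φ).isOpen_compl.mem_nhds hp)]
      with j hj
    exact iff_of_false hj hp

namespace GlobalTypes

variable {L : FirstOrder.Language.{u, v}} {C : Type w} [L.Structure C]

/-- In a saturated structure every filter on finite tuples has a realization over a small set:
a tuple satisfying every formula that holds eventually along the filter. -/
theorem IsSaturated.exists_realize [Nonempty C] {κ : Cardinal.{w}} (h : IsSaturated L C κ)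
    {A : Set C} (hA : #A < κ) {β : Type*} [Finite β] (F : Filter (β → C)) [F.NeBot] :
    ∃ v : β → C, ∀ φ : L.Formula (A ⊕ β),
      (∀ᶠ w in F, φ.Realize (Sum.elim (fun a : A => (a : C)) w)) →
        φ.Realize (Sum.elim (fun a : A => (a : C)) v) := by
  obtain ⟨n, ⟨e⟩⟩ := Finite.exists_equiv_fin β
  let T := L[[A]].completeTheory C
  let U : Ultrafilter (β → C) := Ultrafilter.of F
  let f : (β → C) → T.CompleteType (Fin n) := fun w => T.typeOf (w ∘ e.symm)
  obtain ⟨p, -, hp⟩ := isCompact_univ.ultrafilter_le_nhds (U.map f) (by simp)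
  obtain ⟨v, rfl⟩ := h A hA n p
  refine ⟨v ∘ e, fun φ hφ => ?_⟩
  let S := (sentenceEquivFormula L A (Fin n)).symm (φ.relabel (Sum.map id e))
  have hS : ∀ w : Fin n → C, S ∈ T.typeOf w ↔
      φ.Realize (Sum.elim (fun a : A => (a : C)) (w ∘ e)) := by
    intro w
    rw [mem_typeOf_completeTheory_iff, Equiv.apply_symm_apply, Formula.realize_relabel]
    refine iff_of_eq (congrArg _ ?_)
    ext (s | s) <;> rfl
  have h1 := Theory.CompleteType.eventually_mem_iff_of_tendsto (F := (U : Filter (β → C)))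
    (f := f) hp S
  obtain ⟨w, hw, hw'⟩ := (h1.and (hφ.filter_mono (Ultrafilter.of_le F))).exists
  rw [← hS, ← hw, hS]
  simpa [Function.comp_assoc] using hw'

/-- Filters on countable sequences are realized over the empty set: the terms of the sequence are
found one after the other. -/
theorem IsSaturated.exists_realize_seq [Nonempty C] {κ : Cardinal.{w}} (h : IsSaturated L C κ)
    (hκ : ℵ₀ ≤ κ) (F : Filter (ℕ → C)) [F.NeBot] :
    ∃ v : ℕ → C, ∀ φ : L.Formula ℕ, (∀ᶠ w in F, φ.Realize w) → φ.Realize v := by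
  classical
  let U : Ultrafilter (ℕ → C) := Ultrafilter.of F
  let P : ℕ → (ℕ → C) → Prop := fun k v => ∀ φ : L.Formula (Fin k),
    (∀ᶠ w in (U : Filter (ℕ → C)), φ.Realize (fun i => w i)) → φ.Realize (fun i => v i)
  have h0 : ∀ k, k = 0 → ∀ v, P k v := by
    rintro _ rfl v φ hφ
    obtain ⟨w, hw⟩ := hφ.exists
    rwa [Subsingleton.elim (fun i : Fin 0 => v i) (fun i : Fin 0 => w i)]
  have hstep : ∀ k v, P k v → ∃ e, P (k + 1) (Function.update v k e) := by
    intro k v hv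
    -- The filter generated by the formulas which the next term has to satisfy.
    let s : {φ : L.Formula (Fin (k + 1)) // ∀ᶠ w in (U : Filter (ℕ → C)),
        φ.Realize (fun i => w i)} → Set (Unit → C) := fun φ =>
      {e | φ.1.Realize (fun i : Fin (k + 1) => Function.update v k (e ()) i)}
    have : Nonempty {φ : L.Formula (Fin (k + 1)) // ∀ᶠ w in (U : Filter (ℕ → C)),
        φ.Realize (fun i => w i)} := ⟨⟨⊤, by simp⟩⟩
    have : (⨅ φ, Filter.principal (s φ)).NeBot := by
      refine Filter.iInf_principal_neBot s ?_ ?_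
      · rintro ⟨φ, hφ⟩
        let g : Fin (k + 1) → Fin k ⊕ Unit := Fin.lastCases (Sum.inr ()) Sum.inl
        have hg : ∀ (w : ℕ → C) (e : Unit → C), Sum.elim (fun i : Fin k => w i) e ∘ g =
            fun i : Fin (k + 1) => Function.update w k (e ()) i := by
          intro w e
          funext i
          refine Fin.lastCases ?_ (fun i => ?_) i
          · simp [g]
          · simp [g, Function.update_of_ne i.2.ne]
        have hχ := hv (Formula.iExs Unit (φ.relabel g)) (by
          filter_upwards [hφ] with w hw
          rw [Formula.realize_iExs]
          refine ⟨fun _ => w k, ?_⟩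
          rw [Formula.realize_relabel, hg]
          simpa using hw)
        rw [Formula.realize_iExs] at hχ
        obtain ⟨e, he⟩ := hχ
        rw [Formula.realize_relabel, hg] at he
        exact ⟨e, he⟩
      · rintro ⟨φ, hφ⟩ ⟨ψ, hψ⟩
        refine ⟨⟨φ ⊓ ψ, (hφ.and hψ).mono fun w hw => Formula.realize_inf.2 hw⟩, ?_, ?_⟩
        · exact fun e he => (Formula.realize_inf.1 he).1
        · exact fun e he => (Formula.realize_inf.1 he).2
    let A : Set C := Set.range fun i : Fin k => v i
    have hA : #A < κ := (Cardinal.lt_aleph0_of_finite A).trans_le hκ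
    obtain ⟨e, he⟩ := h.exists_realize hA (⨅ φ, Filter.principal (s φ))
    refine ⟨e (), fun φ hφ => ?_⟩
    let g : Fin (k + 1) → A ⊕ Unit := Fin.lastCases (Sum.inr ()) fun i => Sum.inl ⟨v i, i, rfl⟩
    have hg : ∀ e : Unit → C, Sum.elim (fun a : A => (a : C)) e ∘ g =
        fun i : Fin (k + 1) => Function.update v k (e ()) i := by
      intro e
      funext i
      refine Fin.lastCases ?_ (fun i => ?_) i
      · simp [g]
      · simp [g, Function.update_of_ne i.2.ne]
    rw [← hg e, ← Formula.realize_relabel]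
    refine he _ ?_
    filter_upwards [Filter.eventually_mem_iInf_principal s ⟨φ, hφ⟩] with e' he'
    rw [Formula.realize_relabel, hg]
    exact he'
  choose e he using hstep
  let v₀ : ℕ → C := fun _ => Classical.arbitrary C
  let f : (k : ℕ) → {v : ℕ → C // P k v} := fun k => Nat.rec (motive := fun k => {v : ℕ → C // P k v})
    ⟨v₀, h0 Nat.zero rfl v₀⟩
    (fun k v => ⟨Function.update v.1 k (e k v.1 v.2), he k v.1 v.2⟩) k
  let v : ℕ → C := fun i => (f (i + 1)).1 i
  have hf : ∀ k i, i < k → (f k).1 i = v i := by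
    intro k
    induction k with
    | zero => intro i hi; omega
    | succ k ih =>
      intro i hi
      rcases (Nat.lt_succ_iff.1 hi).eq_or_lt with rfl | hi'
      · rfl
      · rw [← ih i hi']
        exact Function.update_of_ne hi'.ne _ _
  refine ⟨v, fun φ hφ => ?_⟩
  obtain ⟨k, hk⟩ : ∃ k, ∀ i ∈ φ.freeVarFinset, i < k :=
    ⟨φ.freeVarFinset.sup id + 1, fun i hi => Nat.lt_succ_of_le (Finset.le_sup (f := id) hi)⟩
  let ψ : L.Formula (Fin k) := φ.restrictFreeVar fun i => ⟨i.1, hk i.1 i.2⟩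
  have hψ : ∀ w : ℕ → C, ψ.Realize (fun i => w i) ↔ φ.Realize w := fun w =>
    Formula.realize_restrictFreeVar fun _ => rfl
  rw [← hψ]
  have : (fun i : Fin k => v i) = fun i : Fin k => (f k).1 i := funext fun i => (hf k i i.2).symm
  rw [this]
  refine (f k).2 ψ ?_
  filter_upwards [hφ.filter_mono (Ultrafilter.of_le F)] with w hw
  exact (hψ w).2 hw

theorem IsStronglyHomogeneous.exists_equiv {κ : Cardinal.{w}} (h : IsStronglyHomogeneous L C κ)
    (hκ : ℵ₀ ≤ κ) {β : Type*} [Finite β] (a b : β → C)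
    (hab : ∀ φ : L.Formula β, φ.Realize a ↔ φ.Realize b) : ∃ σ : C ≃[L] C, ∀ k, σ (a k) = b k := by
  choose k hk using fun x : Set.range a => x.2
  obtain ⟨σ, hσ⟩ := h (Set.range a) ((Cardinal.lt_aleph0_of_finite _).trans_le hκ)
    (fun x => b (k x)) (fun φ => by
      have h1 := hab (φ.relabel k)
      rw [Formula.realize_relabel, Formula.realize_relabel] at h1
      have h2 : a ∘ k = fun x : Set.range a => (x : C) := funext hk
      rw [← h2]
      exact h1.symm)
  refine ⟨σ, fun i => (hσ ⟨a i, i, rfl⟩).trans ?_⟩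
  have h1 := hab (Term.equal (Term.var (k ⟨a i, i, rfl⟩)) (Term.var i))
  rw [Formula.realize_equal, Formula.realize_equal] at h1
  exact h1.1 (hk _)

end GlobalTypes

/-! ### The type space and the automorphism action -/

namespace GlobalTypes

section Topology

variable {L : FirstOrder.Language.{u, v}} {C : Type w} [L.Structure C] {ι : Type x}

theorem isClosed_typeSpace (c : ι → C) : IsClosed (typeSpace L c) := by
  have : typeSpace L c = ⋂ φ : L.Formula ι,
      {p | parameterFree L C φ ∈ p ↔ φ.Realize c} := by
    ext p
    simp [typeSpace]
  rw [this]
  refine isClosed_iInter fun φ => ?_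
  by_cases h : φ.Realize c
  · simp only [h, iff_true]
    exact CompleteType.isClosed_typesWith (parameterFree L C φ)
  · simp only [h, iff_false]
    exact (CompleteType.isOpen_typesWith (parameterFree L C φ)).isClosed_compl

instance (c : ι → C) : CompactSpace (typeSpace L c) :=
  isCompact_iff_compactSpace.1 (isClosed_typeSpace c).isCompact

/-- A family of types converges as soon as each formula is eventually decided. -/
theorem exists_tendsto_of_decided (c : ι → C) {J : Type*} {F : Filter J} [F.NeBot]
    (f : J → typeSpace L c)
    (h : ∀ φ, (∀ᶠ j in F, φ ∈ (f j).1) ∨ (∀ᶠ j in F, φ ∉ (f j).1)) :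
    ∃ p, Filter.Tendsto f F (nhds p) := by
  let U : Ultrafilter J := Ultrafilter.of F
  let p := (U.map f).lim
  have hp : Filter.Tendsto f U (nhds p) := (U.map f).le_nhds_lim
  have hp' : Filter.Tendsto (fun j => (f j).1) U (nhds p.1) :=
    (continuous_subtype_val.tendsto p).comp hp
  refine ⟨p, ?_⟩
  rw [nhds_subtype_eq_comap, Filter.tendsto_comap_iff, TopologicalSpace.nhds_generateFrom,
    Filter.tendsto_iInf]
  intro s
  rw [Filter.tendsto_iInf]
  rintro ⟨hs, φ, rfl⟩
  rw [Filter.tendsto_principal]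
  rcases h φ with h | h
  · exact h
  · obtain ⟨j, hj, hj'⟩ := ((h.filter_mono (Ultrafilter.of_le F)).and
      (Theory.CompleteType.eventually_mem_iff_of_tendsto hp' φ)).exists
    exact absurd (hj'.2 hs) hj

end Topology

section TypeSpace

variable {L : FirstOrder.Language.{u, v}} {C : Type w} [L.Structure C] [Nonempty C] {ι : Type x}

theorem elementaryDiagram_isComplete : (L.elementaryDiagram C).IsComplete :=
  (completeTheory.isMaximal L[[C]] C).isComplete

theorem paramMap_mem_typeOf_iff (f : C → C) (φ : L[[C]][[ι]].Sentence) (v : ι → C) :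
    (paramMap L ι f).onSentence φ ∈ (L.elementaryDiagram C).typeOf v ↔
      (sentenceEquivFormula L C ι φ).Realize (Sum.elim f v) := by
  let S' : L[[C]].Structure C := withConstantsSelfStructure L
  let T' : L[[C]][[ι]].Structure C :=
    letI : (constantsOn ι).Structure C := constantsOn.structure v
    withConstantsStructure L[[C]] ι
  let S : L[[C]].Structure C :=
    letI : (constantsOn C).Structure C := constantsOn.structure f
    withConstantsStructure L C
  have hS : @LHom.IsExpansionOn _ _ (L.lhomWithConstants C) C _ S :=
    letI : (constantsOn C).Structure C := constantsOn.structure f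
    withConstants_expansion L C
  let T : L[[C]][[ι]].Structure C :=
    letI := S
    letI : (constantsOn ι).Structure C := constantsOn.structure v
    withConstantsStructure L[[C]] ι
  have hexp : @LHom.IsExpansionOn _ _ (paramMap L ι f) C T T' := by
    refine @LHom.IsExpansionOn.mk _ _ _ _ T T' ?_ ?_
    · rintro n ((g | g) | g) xs
      · rfl
      · cases n with
        | zero => rfl
        | succ n => exact isEmptyElim g
      · cases n with
        | zero => rfl
        | succ n => exact isEmptyElim g
    · rintro n ((R | R) | R) xs
      · rfl
      · exact isEmptyElim R
      · exact isEmptyElim R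
  refine Iff.trans (@LHom.realize_onSentence _ _ C T T' (paramMap L ι f) hexp φ) ?_
  let _ := S
  let _ : (constantsOn ι).Structure C := constantsOn.structure v
  have h2 := Formula.realize_equivSentence_symm_con (L := L[[C]]) (α := ι) C φ
  refine h2.symm.trans ?_
  exact (BoundedFormula.realize_constantsVarsEquiv (L := L) (M := C)
    (φ := Formula.equivSentence.symm φ)).symm

theorem mem_autAct_iff (σ : C ≃[L] C) (p : (L.elementaryDiagram C).CompleteType ι)
    (φ : L[[C]][[ι]].Sentence) :
    φ ∈ autAct σ p ↔ (paramMap L ι (σ.symm : C → C)).onSentence φ ∈ p :=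
  Iff.rfl

theorem mem_typeOf_comp_iff (σ : C ≃[L] C) (φ : L[[C]][[ι]].Sentence) (v : ι → C) :
    φ ∈ (L.elementaryDiagram C).typeOf (σ ∘ v) ↔
      (sentenceEquivFormula L C ι φ).Realize (Sum.elim σ.symm v) := by
  rw [mem_typeOf_elementaryDiagram_iff,
    ← StrongHomClass.realize_formula (v := Sum.elim σ.symm v) σ]
  refine iff_of_eq (congrArg _ ?_)
  ext (s | s)
  · simp
  · rfl

theorem autAct_typeOf (σ : C ≃[L] C) (v : ι → C) :
    autAct σ ((L.elementaryDiagram C).typeOf v) = (L.elementaryDiagram C).typeOf (σ ∘ v) :=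
  SetLike.ext fun φ => by
    rw [mem_autAct_iff, paramMap_mem_typeOf_iff, mem_typeOf_comp_iff]

theorem continuous_autAct (σ : C ≃[L] C) :
    Continuous (autAct σ : (L.elementaryDiagram C).CompleteType ι → _) := by
  refine continuous_generateFrom_iff.2 ?_
  rintro _ ⟨φ, rfl⟩
  exact CompleteType.isOpen_typesWith ((paramMap L ι (σ.symm : C → C)).onSentence φ)

theorem denseRange_typeOf :
    DenseRange ((L.elementaryDiagram C).typeOf : (ι → C) → _) := by
  refine CompleteType.isTopologicalBasis_range_typesWith.dense_iff.2 ?_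
  rintro _ ⟨φ, rfl⟩ ⟨p, hp⟩
  obtain ⟨v, hv⟩ := p.exists_mem_typeOf elementaryDiagram_isComplete C hp
  exact ⟨_, hv, v, rfl⟩

/-- Every complete type over `C` agrees on finitely many formulas with a realized type. -/
theorem exists_typeOf_agreeing (p : (L.elementaryDiagram C).CompleteType ι)
    (E : Finset L[[C]][[ι]].Sentence) :
    ∃ v : ι → C, ∀ θ ∈ E, (θ ∈ (L.elementaryDiagram C).typeOf v ↔ θ ∈ p) := by
  have hE : ∀ᶠ r in nhds p, ∀ θ ∈ E, (θ ∈ r ↔ θ ∈ p) :=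
    (Filter.eventually_all_finset _).2 fun θ _ =>
      Theory.CompleteType.eventually_mem_iff_of_tendsto Filter.tendsto_id θ
  obtain ⟨V, hV, hVo, hp⟩ := eventually_nhds_iff.1 hE
  obtain ⟨v, hv⟩ := denseRange_typeOf.exists_mem_open hVo ⟨p, hp⟩
  exact ⟨v, hV _ hv⟩

theorem autAct_autAct (σ τ : C ≃[L] C) (p : (L.elementaryDiagram C).CompleteType ι) :
    autAct σ (autAct τ p) = autAct (σ.comp τ) p := by
  refine congrFun (denseRange_typeOf.equalizer
    ((continuous_autAct σ).comp (continuous_autAct τ)) (continuous_autAct (σ.comp τ)) ?_) p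
  funext v
  simp only [Function.comp_apply, autAct_typeOf]
  rfl

theorem continuous_autActOn (c : ι → C) (σ : C ≃[L] C) : Continuous (autActOn c σ) :=
  ((continuous_autAct σ).comp continuous_subtype_val).subtype_mk _

theorem mem_autType_iff (c : ι → C) (σ : C ≃[L] C) (φ : L[[C]][[ι]].Sentence) :
    φ ∈ (autType c σ).1 ↔ (sentenceEquivFormula L C ι φ).Realize (Sum.elim σ.symm c) :=
  mem_typeOf_comp_iff σ φ c

/-- By saturation and homogeneity, the automorphism group is dense in the type space. -/
theorem denseRange_autType {κ : Cardinal.{w}} (hs : IsSaturated L C κ)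
    (hh : IsStronglyHomogeneous L C κ) (hκ : ℵ₀ ≤ κ) (c : ι → C) :
    DenseRange (autType (L := L) c) := by
  classical
  rw [DenseRange, dense_iff_inter_open]
  rintro _ ⟨V, hV, rfl⟩ ⟨p, hp⟩
  obtain ⟨_, ⟨θ, rfl⟩, hpθ, hθV⟩ :=
    CompleteType.isTopologicalBasis_range_typesWith.exists_subset_of_mem_open hp hV
  suffices h : ∃ σ : C ≃[L] C, θ ∈ (autType c σ).1 by
    obtain ⟨σ, hσ⟩ := h
    exact ⟨_, hθV hσ, σ, rfl⟩
  let θ' := sentenceEquivFormula L C ι θ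
  let A : Set C := (θ'.freeVarFinset.toLeft : Set C)
  let β : Type _ := θ'.freeVarFinset.toRight
  -- The filter of realizations of `p`, restricted to the finitely many variables of `θ`.
  let s : {φ // φ ∈ p.1} → Set (ι → C) := fun φ => {v | φ.1 ∈ (L.elementaryDiagram C).typeOf v}
  have : Nonempty {φ // φ ∈ p.1} := ⟨⟨θ, hpθ⟩⟩
  have : (⨅ φ, Filter.principal (s φ)).NeBot := by
    refine Filter.iInf_principal_neBot s ?_ ?_
    · rintro ⟨φ, hφ⟩
      exact p.1.exists_mem_typeOf elementaryDiagram_isComplete C hφ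
    · rintro ⟨φ, hφ⟩ ⟨ψ, hψ⟩
      have h : ∀ r : (L.elementaryDiagram C).CompleteType ι, φ ⊓ ψ ∈ r ↔ φ ∈ r ∧ ψ ∈ r := by
        intro r
        simp only [← Theory.CompleteType.mem_typesWith_iff, Theory.CompleteType.typesWith_inf]
        rfl
      exact ⟨⟨φ ⊓ ψ, (h _).2 ⟨hφ, hψ⟩⟩, fun v hv => ((h (Theory.typeOf _ v)).1 hv).1,
        fun v hv => ((h (Theory.typeOf _ v)).1 hv).2⟩
  let G : Filter (β → C) := (⨅ φ, Filter.principal (s φ)).map fun v i => v i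
  obtain ⟨e, he⟩ := hs.exists_realize
    ((Cardinal.lt_aleph0_of_finite A).trans_le hκ) G
  have hfree : ∀ χ : L.Formula ι,
      ∀ᶠ v in ⨅ φ, Filter.principal (s φ), (χ.Realize v ↔ χ.Realize c) := by
    intro χ
    by_cases hχ : χ.Realize c
    · filter_upwards [Filter.eventually_mem_iInf_principal s
        ⟨parameterFree L C χ, (p.2 χ).2 hχ⟩] with v hv
      exact iff_of_true ((parameterFree_mem_typeOf v χ).1 hv) hχ
    · have hχ' : χ.not.Realize c := hχ
      filter_upwards [Filter.eventually_mem_iInf_principal s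
        ⟨parameterFree L C χ.not, (p.2 χ.not).2 hχ'⟩] with v hv
      exact iff_of_false ((parameterFree_mem_typeOf v χ.not).1 hv) hχ
  have himp : ∀ χ : L.Formula β, χ.Realize (fun i => c i) → χ.Realize e := by
    intro χ hχ
    have h := he (χ.relabel Sum.inr) (by
      rw [Filter.eventually_map]
      filter_upwards [hfree (χ.relabel Subtype.val)] with v hv
      rw [Formula.realize_relabel] at hv ⊢
      exact hv.2 (Formula.realize_relabel.2 hχ))
    rwa [Formula.realize_relabel] at h
  obtain ⟨σ, hσ⟩ := hh.exists_equiv hκ (fun i : β => c i) e fun χ =>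
    ⟨himp χ, fun h => by_contra fun h' => himp χ.not h' h⟩
  refine ⟨σ, ?_⟩
  let f : θ'.freeVarFinset → A ⊕ β
    | ⟨.inl a, h⟩ => .inl ⟨a, Finset.mem_toLeft.2 h⟩
    | ⟨.inr i, h⟩ => .inr ⟨i, Finset.mem_toRight.2 h⟩
  have hσθ := he (θ'.restrictFreeVar f) (by
    rw [Filter.eventually_map]
    filter_upwards [Filter.eventually_mem_iInf_principal s ⟨θ, hpθ⟩] with v hv
    refine (Formula.realize_restrictFreeVar (v' := Sum.elim id v) ?_).2
      ((mem_typeOf_elementaryDiagram_iff θ v).1 hv)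
    rintro ⟨a | i, h⟩ <;> rfl)
  refine (mem_typeOf_elementaryDiagram_iff θ _).2
    ((Formula.realize_restrictFreeVar (f := f) ?_).1 hσθ)
  rintro ⟨a | i, h⟩
  · rfl
  · exact (hσ ⟨i, Finset.mem_toRight.2 h⟩).symm

end TypeSpace

end GlobalTypes

/-! ### Without the order property, the action extends to a semigroup operation -/

namespace GlobalTypes

section Extension

variable {L : FirstOrder.Language.{u, v}} {C : Type w} [L.Structure C] [Nonempty C] {ι : Type x}

/-- Without the order property, whether `φ` belongs to `σ(q)` depends only on the truth of finitely
many formulas at `σ(c)`. -/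
theorem exists_finset_mem_autAct_iff (h : ¬ L.HasOrderFormula C) {c : ι → C}
    (hc : Function.Surjective c) (q : (L.elementaryDiagram C).CompleteType ι)
    (φ : L[[C]][[ι]].Sentence) :
    ∃ E : Finset L[[C]][[ι]].Sentence, ∀ σ τ : C ≃[L] C,
      (∀ θ ∈ E, (θ ∈ (autType c σ).1 ↔ θ ∈ (autType c τ).1)) →
        (φ ∈ autAct σ q ↔ φ ∈ autAct τ q) := by
  classical
  let R : (ι → C) → (C ≃[L] C) → Prop := fun v σ =>
    (sentenceEquivFormula L C ι φ).Realize (Sum.elim σ.symm v)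
  have hR : ¬ HasOrderProperty R := by
    intro hR
    refine h (HasOrderFormula.of_formula
      ((sentenceEquivFormula L C ι φ).relabel (Sum.swap : C ⊕ ι → ι ⊕ C)) fun N => ?_)
    obtain ⟨a, b, hab⟩ := hR N
    refine ⟨a, fun j => (b j).symm, fun i hi j hj => ?_⟩
    rw [← hab i hi j hj]
    refine Formula.realize_relabel.trans ?_
    refine iff_of_eq (congrArg _ ?_)
    ext (s | s) <;> rfl
  have hq : ∀ B : Finset (C ≃[L] C), ∃ v, ∀ σ ∈ B, (R v σ ↔ φ ∈ autAct σ q) := by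
    intro B
    obtain ⟨v, hv⟩ := exists_typeOf_agreeing q
      (B.image fun σ => (paramMap L ι (σ.symm : C → C)).onSentence φ)
    refine ⟨v, fun σ hσ => ?_⟩
    rw [mem_autAct_iff, ← hv _ (Finset.mem_image_of_mem _ hσ), paramMap_mem_typeOf_iff]
  obtain ⟨E, hE⟩ := exists_finset_of_not_hasOrderProperty hR hq
  choose g hg using hc
  let F : (ι → C) → L[[C]][[ι]].Sentence := fun v => (sentenceEquivFormula L C ι).symm
    ((sentenceEquivFormula L C ι φ).relabel (Sum.map id fun i => g (v i)))
  have hF : ∀ v σ, F v ∈ (autType c σ).1 ↔ R v σ := by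
    intro v σ
    rw [mem_autType_iff, Equiv.apply_symm_apply, Formula.realize_relabel]
    refine iff_of_eq (congrArg _ ?_)
    ext (s | s)
    · rfl
    · exact hg _
  refine ⟨E.image F, fun σ τ hστ => hE σ τ fun v hv => ?_⟩
  rw [← hF, ← hF]
  exact hστ _ (Finset.mem_image_of_mem F hv)

/-- Without the order property, the action of the automorphism group on the type space extends by
continuity to a semigroup operation. -/
theorem exists_semigroup_operation {κ : Cardinal.{w}} (hs : IsSaturated L C κ)
    (hh : IsStronglyHomogeneous L C κ) (hκ : ℵ₀ ≤ κ) (h : ¬ L.HasOrderFormula C) {c : ι → C}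
    (hc : Function.Surjective c) :
    ∃ op : typeSpace L c → typeSpace L c → typeSpace L c,
      (∀ p q r, op (op p q) r = op p (op q r)) ∧
      (∀ q, Continuous fun p => op p q) ∧
      (∀ (σ : C ≃[L] C) (q : typeSpace L c), op (autType c σ) q = autActOn c σ q) := by
  have hd := denseRange_autType hs hh hκ c
  -- With the topology induced by the type space, `σ ↦ σ(q)` extends by continuity.
  let _ : TopologicalSpace (C ≃[L] C) := TopologicalSpace.induced (autType c) inferInstance
  have hdi : IsDenseInducing (autType (L := L) c) := ⟨⟨rfl⟩, hd⟩
  have hlim : ∀ q p : typeSpace L c, ∃ r,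
      Filter.Tendsto (fun σ => autActOn c σ q) ((nhds p).comap (autType c)) (nhds r) := by
    intro q p
    have : ((nhds p).comap (autType (L := L) c)).NeBot := hdi.comap_nhds_neBot p
    refine exists_tendsto_of_decided c _ fun φ => ?_
    obtain ⟨E, hE⟩ := exists_finset_mem_autAct_iff h hc q.1 φ
    have hev : ∀ᶠ σ in (nhds p).comap (autType (L := L) c),
        ∀ θ ∈ E, (θ ∈ (autType c σ).1 ↔ θ ∈ p.1) :=
      (Filter.eventually_all_finset _).2 fun θ _ =>
        Theory.CompleteType.eventually_mem_iff_of_tendsto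
          ((continuous_subtype_val.tendsto p).comp Filter.tendsto_comap) θ
    obtain ⟨τ, hτ⟩ := hev.exists
    have hdec : ∀ᶠ σ in (nhds p).comap (autType (L := L) c),
        (φ ∈ autAct σ q.1 ↔ φ ∈ autAct τ q.1) := by
      filter_upwards [hev] with σ hσ
      exact hE σ τ fun θ hθ => (hσ θ hθ).trans (hτ θ hθ).symm
    by_cases hφ : φ ∈ autAct τ q.1
    · exact Or.inl (hdec.mono fun σ hσ => hσ.2 hφ)
    · exact Or.inr (hdec.mono fun σ hσ h => hφ (hσ.1 h))
  let op : typeSpace L c → typeSpace L c → typeSpace L c := fun p q =>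
    hdi.extend (fun σ => autActOn c σ q) p
  have hcont : ∀ q, Continuous fun p => op p q := fun q => hdi.continuous_extend (hlim q)
  have hact : ∀ (σ : C ≃[L] C) (q : typeSpace L c), op (autType c σ) q = autActOn c σ q := by
    intro σ q
    obtain ⟨r, hr⟩ := hlim q (autType c σ)
    rw [← hdi.nhds_eq_comap] at hr
    exact hdi.extend_eq_at' r hr
  refine ⟨op, fun p q r => ?_, hcont, hact⟩
  refine congrFun (hd.equalizer (g := fun p => op (op p q) r) ((hcont r).comp (hcont q))
    (hcont (op q r)) ?_) p
  funext σ
  simp only [Function.comp_apply, hact]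
  refine congrFun (hd.equalizer (g := fun q => op (autActOn c σ q) r)
    ((hcont r).comp (continuous_autActOn c σ))
    ((continuous_autActOn c σ).comp (hcont r)) ?_) q
  funext τ
  have h1 : autActOn c σ (autType c τ) = autType c (σ.comp τ) :=
    Subtype.ext (autAct_typeOf σ _)
  simp only [Function.comp_apply, hact, h1]
  exact Subtype.ext (autAct_autAct σ τ r.1).symm

end Extension

end GlobalTypes

/-! ### A semigroup operation excludes the order property -/

namespace GlobalTypes

section Order

variable {L : FirstOrder.Language.{u, v}} {C : Type w} [L.Structure C]

/-- An ordered sequence of length `N` whose terms agree on finitely many formulas is found by the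
pigeonhole principle in any long enough ordered sequence. -/
theorem exists_ordered_agreeing {n : ℕ} {φ : L.Formula (Fin n ⊕ Fin n)}
    (h : HasOrderProperty fun (a b : Fin n → C) => φ.Realize (Sum.elim a b)) (N : ℕ)
    (S : Finset (L.Formula (Fin n ⊕ Fin n))) :
    ∃ d : ℕ → Fin n ⊕ Fin n → C,
      (∀ i < N, ∀ j < N,
        (φ.Realize (Sum.elim (fun s => d i (Sum.inl s)) fun s => d j (Sum.inr s)) ↔ i < j)) ∧
      ∀ i < N, ∀ j < N, ∀ χ ∈ S, (χ.Realize (d i) ↔ χ.Realize (d j)) := by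
  classical
  let K := S.powerset.card
  obtain ⟨a, b, hab⟩ := h (K * N)
  let e : ℕ → Fin n ⊕ Fin n → C := fun i => Sum.elim (a i) (b i)
  let color : ℕ → Finset (L.Formula (Fin n ⊕ Fin n)) := fun i => {χ ∈ S | χ.Realize (e i)}
  obtain ⟨y, -, hy⟩ := Finset.exists_le_card_fiber_of_mul_le_card_of_maps_to
    (s := Finset.range (K * N)) (t := S.powerset) (f := color) (n := N)
    (fun i _ => Finset.mem_powerset.2 (Finset.filter_subset _ _))
    ⟨∅, Finset.empty_mem_powerset S⟩ (by simp [K])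
  let g := Finset.orderEmbOfCardLe _ hy
  have hg : ∀ i, g i < K * N ∧ color (g i) = y := by
    intro i
    have := Finset.orderEmbOfCardLe_mem _ hy i
    simpa using this
  let g' : ℕ → ℕ := fun i => if hi : i < N then g ⟨i, hi⟩ else 0
  refine ⟨fun i => e (g' i), fun i hi j hj => ?_, fun i hi j hj χ hχ => ?_⟩
  · simp only [g', hi, hj, dif_pos]
    refine (hab _ (hg _).1 _ (hg _).1).trans ?_
    rw [g.lt_iff_lt]
    exact Iff.rfl
  · simp only [g', hi, hj, dif_pos]
    have h1 : color (g ⟨i, hi⟩) = color (g ⟨j, hj⟩) := (hg _).2.trans (hg _).2.symm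
    have h2 := Finset.ext_iff.1 h1 χ
    simpa [color, hχ] using h2

/-- In a saturated structure the order property is witnessed by an infinite sequence, all of whose
terms have the same type. -/
theorem IsSaturated.exists_ordered_seq [Nonempty C] {κ : Cardinal.{w}} (hs : IsSaturated L C κ) (hκ : ℵ₀ ≤ κ)
    {n : ℕ} {φ : L.Formula (Fin n ⊕ Fin n)}
    (h : HasOrderProperty fun (a b : Fin n → C) => φ.Realize (Sum.elim a b)) :
    ∃ d : ℕ → Fin n ⊕ Fin n → C,
      (∀ i j, φ.Realize (Sum.elim (fun s => d i (Sum.inl s)) fun s => d j (Sum.inr s)) ↔ i < j) ∧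
      ∀ i j (χ : L.Formula (Fin n ⊕ Fin n)), χ.Realize (d i) ↔ χ.Realize (d j) := by
  classical
  let enc : ℕ × (Fin n ⊕ Fin n) → ℕ := Encodable.encode
  have henc : Function.Injective enc := Encodable.encode_injective
  let s : ℕ × Finset (L.Formula (Fin n ⊕ Fin n)) → Set (ℕ → C) := fun p => {w |
    (∀ i < p.1, ∀ j < p.1, (φ.Realize (Sum.elim (fun s => w (enc (i, Sum.inl s)))
      fun s => w (enc (j, Sum.inr s))) ↔ i < j)) ∧
    ∀ i < p.1, ∀ j < p.1, ∀ χ ∈ p.2, (χ.Realize (fun s => w (enc (i, s))) ↔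
      χ.Realize (fun s => w (enc (j, s))))}
  have : (⨅ p, Filter.principal (s p)).NeBot := by
    refine Filter.iInf_principal_neBot s ?_ ?_
    · rintro ⟨N, S⟩
      obtain ⟨d, hd⟩ := exists_ordered_agreeing h N S
      refine ⟨Function.extend enc (fun p => d p.1 p.2) fun _ => Classical.arbitrary C, ?_⟩
      simp only [s, Set.mem_ofPred_eq, henc.extend_apply]
      exact hd
    · rintro ⟨N, S⟩ ⟨N', S'⟩
      refine ⟨(max N N', S ∪ S'), fun w hw => ⟨fun i hi j hj => ?_, fun i hi j hj χ hχ => ?_⟩,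
        fun w hw => ⟨fun i hi j hj => ?_, fun i hi j hj χ hχ => ?_⟩⟩
      · exact hw.1 i (lt_max_of_lt_left hi) j (lt_max_of_lt_left hj)
      · exact hw.2 i (lt_max_of_lt_left hi) j (lt_max_of_lt_left hj) χ
          (Finset.mem_union_left _ hχ)
      · exact hw.1 i (lt_max_of_lt_right hi) j (lt_max_of_lt_right hj)
      · exact hw.2 i (lt_max_of_lt_right hi) j (lt_max_of_lt_right hj) χ
          (Finset.mem_union_right _ hχ)
  obtain ⟨w, hw⟩ := hs.exists_realize_seq hκ (⨅ p, Filter.principal (s p))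
  refine ⟨fun i t => w (enc (i, t)), fun i j => ?_, fun i j χ => ?_⟩
  · let ψ : L.Formula ℕ := φ.relabel
      (Sum.elim (fun t => enc (i, Sum.inl t)) fun t => enc (j, Sum.inr t))
    have hψ : ∀ w : ℕ → C, ψ.Realize w ↔ φ.Realize (Sum.elim (fun t => w (enc (i, Sum.inl t)))
        fun t => w (enc (j, Sum.inr t))) := by
      intro w
      rw [Formula.realize_relabel]
      refine iff_of_eq (congrArg _ ?_)
      ext (t | t) <;> rfl
    rw [← hψ]
    have hev := Filter.eventually_mem_iInf_principal s (max i j + 1, ∅)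
    have hev' : ∀ᶠ w in ⨅ p, Filter.principal (s p), (ψ.Realize w ↔ i < j) := by
      filter_upwards [hev] with w hw
      rw [hψ]
      exact hw.1 i (by simp only; omega) j (by simp only; omega)
    by_cases hij : i < j
    · exact iff_of_true (hw ψ (hev'.mono fun w h => h.2 hij)) hij
    · refine iff_of_false (hw ψ.not (hev'.mono fun w h => ?_)) hij
      exact fun h' => hij (h.1 h')
  · let ψ : L.Formula ℕ := (χ.relabel fun t => enc (i, t)).iff (χ.relabel fun t => enc (j, t))
    have hψ := hw ψ (by
      filter_upwards [Filter.eventually_mem_iInf_principal s (max i j + 1, {χ})] with w hw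
      rw [Formula.realize_iff, Formula.realize_relabel, Formula.realize_relabel]
      exact hw.2 i (by simp only; omega) j (by simp only; omega) χ (Finset.mem_singleton_self χ))
    rwa [Formula.realize_iff, Formula.realize_relabel, Formula.realize_relabel] at hψ

/-- A double limit argument. For an ordered sequence `(xᵢ, yⱼ)` of constant type, let `p` and `q` be
the limits of automorphisms `σⱼ` and `τᵢ` with `σⱼ yⱼ = y₀` and `τᵢ x₀ = xᵢ`. In `p * q` the limit
in `i` is taken first, so the formula ordering the sequence fails at `x₀, y₀`, and by continuity in
`p` it fails in `σ * q` for all `σ` near `p`. An automorphism near `p` which moves to `y₀` a tuple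
lying above all `xᵢ` contradicts this. -/
theorem not_hasOrderFormula_of_operation [Nonempty C] {κ : Cardinal.{w}} (hs : IsSaturated L C κ)
    (hh : IsStronglyHomogeneous L C κ) (hκ : ℵ₀ < κ) {ι : Type x} {c : ι → C}
    (hc : Function.Surjective c) (op : typeSpace L c → typeSpace L c → typeSpace L c)
    (hcont : ∀ q, Continuous fun p => op p q)
    (hact : ∀ (σ : C ≃[L] C) (q : typeSpace L c), op (autType c σ) q = autActOn c σ q) :
    ¬ L.HasOrderFormula C := by
  classical
  rintro ⟨n, φ, hφ⟩
  obtain ⟨d, hd, htype⟩ := hs.exists_ordered_seq hκ.le hφ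
  let a : ℕ → Fin n → C := fun i s => d i (Sum.inl s)
  let b : ℕ → Fin n → C := fun i s => d i (Sum.inr s)
  have hab : ∀ i j, φ.Realize (Sum.elim (a i) (b j)) ↔ i < j := hd
  have hσ : ∀ j, ∃ σ : C ≃[L] C, ∀ k, σ (b j k) = b 0 k := fun j =>
    hh.exists_equiv hκ.le (b j) (b 0) fun χ => by
      have := htype j 0 (χ.relabel Sum.inr)
      rwa [Formula.realize_relabel, Formula.realize_relabel] at this
  have hτ : ∀ i, ∃ τ : C ≃[L] C, ∀ k, τ (a 0 k) = a i k := fun i =>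
    hh.exists_equiv hκ.le (a 0) (a i) fun χ => by
      have := htype 0 i (χ.relabel Sum.inl)
      rwa [Formula.realize_relabel, Formula.realize_relabel] at this
  choose σ hσ using hσ
  choose τ hτ using hτ
  choose g hg using fun k => hc (a 0 k)
  let U : Ultrafilter ℕ := Filter.hyperfilter ℕ
  let p := (U.map fun j => autType c (σ j)).lim
  let q := (U.map fun i => autType c (τ i)).lim
  have hp : Filter.Tendsto (fun j => autType c (σ j)) U (nhds p) :=
    (U.map fun j => autType c (σ j)).le_nhds_lim
  have hq : Filter.Tendsto (fun i => autType c (τ i)) U (nhds q) :=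
    (U.map fun i => autType c (τ i)).le_nhds_lim
  have hq' := (continuous_subtype_val.tendsto q).comp hq
  let Φ : L[[C]][[ι]].Sentence := (sentenceEquivFormula L C ι).symm
    (φ.relabel (Sum.elim (fun k => Sum.inr (g k)) fun k => Sum.inl (b 0 k)))
  have hΦ : ∀ ρ : C ≃[L] C, Φ ∈ (op (autType c ρ) q).1 ↔
      ∀ᶠ i in (U : Filter ℕ), φ.Realize (Sum.elim (a i) fun k => ρ.symm (b 0 k)) := by
    intro ρ
    rw [hact]
    have hi : ∀ i, (paramMap L ι (ρ.symm : C → C)).onSentence Φ ∈ (autType c (τ i)).1 ↔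
        φ.Realize (Sum.elim (a i) fun k => ρ.symm (b 0 k)) := by
      intro i
      refine (paramMap_mem_typeOf_iff _ _ _).trans ?_
      rw [Equiv.apply_symm_apply, Formula.realize_relabel]
      refine iff_of_eq (congrArg _ ?_)
      ext (k | k)
      · simp [hg, hτ]
      · rfl
    have hev := Theory.CompleteType.eventually_mem_iff_of_tendsto hq'
      ((paramMap L ι (ρ.symm : C → C)).onSentence Φ)
    simp only [Function.comp_apply, hi] at hev
    change (paramMap L ι (ρ.symm : C → C)).onSentence Φ ∈ q.1 ↔ _
    constructor
    · intro hmem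
      exact hev.mono fun i h => h.2 hmem
    · intro hmem
      obtain ⟨i, h1, h2⟩ := (hev.and hmem).exists
      exact h1.1 h2
  have hUtop : (U : Filter ℕ) ≤ Filter.atTop := Nat.hyperfilter_le_atTop
  have hσΦ : ∀ j, Φ ∉ (op (autType c (σ j)) q).1 := by
    intro j hj
    rw [hΦ] at hj
    obtain ⟨i, h1, h2⟩ := (hj.and ((Filter.eventually_ge_atTop j).filter_mono hUtop)).exists
    have : (fun k => (σ j).symm (b 0 k)) = b j := funext fun k => by
      rw [← hσ j k]; simp
    rw [this, hab] at h1
    omega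
  have hopen : IsOpen {r : typeSpace L c | Φ ∉ (op r q).1} :=
    (CompleteType.isClosed_typesWith Φ).isOpen_compl.preimage
      (continuous_subtype_val.comp (hcont q))
  have hpΦ : Φ ∉ (op p q).1 := by
    have hcl : IsClosed {r : typeSpace L c | Φ ∉ (op r q).1} :=
      (CompleteType.isOpen_typesWith Φ).isClosed_compl.preimage
        (continuous_subtype_val.comp (hcont q))
    exact hcl.mem_of_tendsto hp (Filter.Eventually.of_forall hσΦ)
  obtain ⟨V, hV, hVeq⟩ := isOpen_induced_iff.1 hopen
  have hpV : p.1 ∈ V := by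
    change p ∈ Subtype.val ⁻¹' V
    rw [hVeq]
    exact hpΦ
  obtain ⟨_, ⟨θ, rfl⟩, hpθ, hθV⟩ :=
    CompleteType.isTopologicalBasis_range_typesWith.exists_subset_of_mem_open hpV hV
  have hθ : ∀ r : typeSpace L c, θ ∈ r.1 → Φ ∉ (op r q).1 := by
    intro r hr
    have : r ∈ Subtype.val ⁻¹' V := hθV hr
    rwa [hVeq] at this
  have hσθ : ∀ᶠ j in (U : Filter ℕ), θ ∈ (autType c (σ j)).1 :=
    ((continuous_subtype_val.tendsto p).comp hp).eventually
      ((CompleteType.isOpen_typesWith θ).mem_nhds hpθ)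
  let θ' := sentenceEquivFormula L C ι θ
  -- The parameters moved by the automorphism, and the elements that have to be kept in place.
  let β : Finset C := θ'.freeVarFinset.toLeft ∪ Finset.univ.image (b 0)
  let A : Set C := (Set.range fun s : ℕ × Fin n => a s.1 s.2) ∪ (θ'.freeVarFinset.toRight.image c)
  have hA : #A < κ :=
    ((Set.countable_range _).union (Finset.countable_toSet _)).le_aleph0.trans_lt hκ
  let G : Filter (β → C) := (U : Filter ℕ).map fun j t => (σ j).symm t
  obtain ⟨e, he⟩ := hs.exists_realize hA G
  have himp : ∀ χ : L.Formula β, χ.Realize (fun t : β => (t : C)) → χ.Realize e := by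
    intro χ hχ
    have h := he (χ.relabel Sum.inr) (by
      rw [Filter.eventually_map]
      refine Filter.Eventually.of_forall fun j => ?_
      rw [Formula.realize_relabel]
      exact (StrongHomClass.realize_formula (v := fun t : β => (t : C)) (σ j).symm χ).2 hχ)
    rwa [Formula.realize_relabel] at h
  obtain ⟨ρ, hρ⟩ := hh.exists_equiv hκ.le (fun t : β => (t : C)) e fun χ =>
    ⟨himp χ, fun h => by_contra fun h' => himp χ.not h' h⟩
  have hρθ : θ ∈ (autType c ρ.symm).1 := by
    rw [mem_autType_iff]
    let f : θ'.freeVarFinset → A ⊕ β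
      | ⟨.inl t, h⟩ => .inr ⟨t, Finset.mem_union_left _ (Finset.mem_toLeft.2 h)⟩
      | ⟨.inr i, h⟩ => .inl ⟨c i, Or.inr (Finset.mem_image_of_mem c (Finset.mem_toRight.2 h))⟩
    refine (Formula.realize_restrictFreeVar (f := f) ?_).1 (he (θ'.restrictFreeVar f) ?_)
    · rintro ⟨t | i, h⟩
      · exact (hρ ⟨t, _⟩).symm
      · rfl
    · rw [Filter.eventually_map]
      filter_upwards [hσθ] with j hj
      refine (Formula.realize_restrictFreeVar ?_).2 ((mem_autType_iff c (σ j) θ).1 hj)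
      rintro ⟨t | i, h⟩ <;> rfl
  refine hθ _ hρθ ((hΦ ρ.symm).2 (Filter.Eventually.of_forall fun i => ?_))
  have hb : ∀ k, b 0 k ∈ β := fun k =>
    Finset.mem_union_right _ (Finset.mem_image_of_mem _ (Finset.mem_univ k))
  let f : Fin n ⊕ Fin n → A ⊕ β :=
    Sum.map (fun k => ⟨a i k, Or.inl ⟨(i, k), rfl⟩⟩) fun k => ⟨b 0 k, hb k⟩
  have h := he (φ.relabel f) (by
    rw [Filter.eventually_map]
    filter_upwards [(Filter.eventually_gt_atTop i).filter_mono hUtop] with j hj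
    rw [Formula.realize_relabel]
    refine (iff_of_eq (congrArg _ ?_)).1 ((hab i j).2 hj)
    ext (k | k)
    · rfl
    · simp [f, ← hσ j k])
  rw [Formula.realize_relabel] at h
  refine (iff_of_eq (congrArg _ ?_)).1 h
  ext (k | k)
  · rfl
  · exact (hρ ⟨b 0 k, hb k⟩).symm

end Order

end GlobalTypes

/-! ### Counting types without the order property -/

theorem Cardinal.mk_finset_le {X : Type u} {μ : Cardinal.{u}} (hμ : ℵ₀ ≤ μ) (hX : #X ≤ μ) :
    #(Finset X) ≤ μ := by
  rcases finite_or_infinite X with h | h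
  · exact (Cardinal.lt_aleph0_of_finite _).le.trans hμ
  · rwa [Cardinal.mk_finset_of_infinite]

/-- The finite data that determine a definable limit of sections: a finite set `E` and the family of
traces on `E` of the sections where the limit holds. -/
theorem exists_code_of_not_hasOrderProperty {X Y : Type*} [DecidableEq X] {R : X → Y → Prop}
    [∀ x y, Decidable (R x y)] (hR : ¬ HasOrderProperty R)
    {q : Y → Prop} (hq : ∀ B : Finset Y, ∃ x, ∀ y ∈ B, (R x y ↔ q y)) :
    ∃ d : Finset X × Finset (Finset X), ∀ y, q y ↔ {x ∈ d.1 | R x y} ∈ d.2 := by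
  classical
  obtain ⟨E, hE⟩ := exists_finset_of_not_hasOrderProperty hR hq
  refine ⟨(E, {F ∈ E.powerset | ∃ y, q y ∧ {x ∈ E | R x y} = F}), fun y => ?_⟩
  simp only [Finset.mem_filter, Finset.mem_powerset, Finset.filter_subset, true_and]
  constructor
  · exact fun h => ⟨y, h, rfl⟩
  · rintro ⟨y', hy', h⟩
    refine (hE y' y fun x hx => ?_).1 hy'
    have := Finset.ext_iff.1 h x
    simpa [hx] using this

namespace GlobalTypes

variable {L : FirstOrder.Language.{u, v}}

theorem mk_formula_le (α : Type) [Countable α] : #(L.Formula α) ≤ max ℵ₀ L.card := by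
  have h1 : #(L.Formula α) ≤ #(Σ n, L.BoundedFormula α n) :=
    Cardinal.mk_le_of_injective (f := fun φ : L.Formula α => ⟨0, φ⟩) fun φ ψ h => by
      simpa using h
  have h2 := BoundedFormula.card_le (L := L) (α := α)
  rw [Cardinal.lift_id'.{0, max u v}] at h2
  refine h1.trans (h2.trans (max_le (le_max_left _ _) ?_))
  refine (Cardinal.add_le_max _ _).trans (max_le (max_le ?_ (le_max_right _ _)) (le_max_left _ _))
  refine le_trans ?_ (le_max_left _ _)
  rw [Cardinal.lift_le_aleph0]
  exact Cardinal.mk_le_aleph0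

/-- Without the order property, a type over `M` is determined by finite data for each formula
without parameters, so there are at most `|M| ^ |T|` types over `M`. -/
theorem mk_completeType_le_of_not_hasOrderFormula {M : Type (max u v)} [L.Structure M]
    [Nonempty M] (h : ¬ L.HasOrderFormula M) {μ : Cardinal.{max u v}} (hμ : ℵ₀ ≤ μ)
    (hM : #M ≤ μ) :
    #((L.elementaryDiagram M).CompleteType (Fin 1)) ≤ μ ^ (max ℵ₀ L.card) := by
  classical
  let S : L.Formula (ℕ ⊕ Fin 1) → (ℕ → M) → L[[M]][[Fin 1]].Sentence := fun ψ b =>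
    (sentenceEquivFormula L M (Fin 1)).symm (ψ.relabel (Sum.map b id))
  let R : L.Formula (ℕ ⊕ Fin 1) → (Fin 1 → M) → (ℕ → M) → Prop := fun ψ a b =>
    ψ.Realize (Sum.elim b a)
  have hSR : ∀ ψ a b, S ψ b ∈ (L.elementaryDiagram M).typeOf a ↔ R ψ a b := by
    intro ψ a b
    rw [mem_typeOf_elementaryDiagram_iff, Equiv.apply_symm_apply, Formula.realize_relabel]
    refine iff_of_eq (congrArg _ ?_)
    ext (s | s) <;> rfl
  have hR : ∀ ψ, ¬ HasOrderProperty (R ψ) := by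
    intro ψ hψ
    refine h (HasOrderFormula.of_formula (ψ.relabel (Sum.swap : ℕ ⊕ Fin 1 → Fin 1 ⊕ ℕ))
      fun N => ?_)
    obtain ⟨a, b, hab⟩ := hψ N
    refine ⟨a, b, fun i hi j hj => ?_⟩
    rw [← hab i hi j hj]
    refine Formula.realize_relabel.trans (iff_of_eq (congrArg _ ?_))
    ext (s | s) <;> rfl
  have hcode : ∀ (p : (L.elementaryDiagram M).CompleteType (Fin 1)) (ψ : L.Formula (ℕ ⊕ Fin 1)),
      ∃ d : Finset (Fin 1 → M) × Finset (Finset (Fin 1 → M)),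
        ∀ b, S ψ b ∈ p ↔ {a ∈ d.1 | R ψ a b} ∈ d.2 := by
    intro p ψ
    refine exists_code_of_not_hasOrderProperty (hR ψ) fun B => ?_
    obtain ⟨a, ha⟩ := exists_typeOf_agreeing p (B.image (S ψ))
    exact ⟨a, fun b hb => by rw [← ha _ (Finset.mem_image_of_mem _ hb), hSR]⟩
  choose code hcode using hcode
  -- Every formula with parameters is an instance of a formula with variables indexed by `ℕ`.
  have hS : ∀ φ, ∃ ψ b, ∀ a : Fin 1 → M, S ψ b ∈ (L.elementaryDiagram M).typeOf a ↔
      φ ∈ (L.elementaryDiagram M).typeOf a := by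
    intro φ
    let θ := sentenceEquivFormula L M (Fin 1) φ
    let e := θ.freeVarFinset.toLeft.equivFin
    let b : ℕ → M := fun k => if hk : k < θ.freeVarFinset.toLeft.card then e.symm ⟨k, hk⟩ else
      Classical.arbitrary M
    let f : θ.freeVarFinset → ℕ ⊕ Fin 1
      | ⟨.inl m, h⟩ => .inl (e ⟨m, Finset.mem_toLeft.2 h⟩)
      | ⟨.inr i, _⟩ => .inr i
    refine ⟨θ.restrictFreeVar f, b, fun a => ?_⟩
    rw [hSR, mem_typeOf_elementaryDiagram_iff]
    refine Formula.realize_restrictFreeVar ?_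
    rintro ⟨m | i, h⟩
    · simp [f, b]
    · rfl
  have hinj : Function.Injective code := by
    intro p p' hp
    refine SetLike.ext fun φ => ?_
    obtain ⟨ψ, b, hψ⟩ := hS φ
    have hmem : ∀ p : (L.elementaryDiagram M).CompleteType (Fin 1), S ψ b ∈ p ↔ φ ∈ p := by
      intro p
      obtain ⟨a, ha⟩ := exists_typeOf_agreeing p {S ψ b, φ}
      rw [← ha (S ψ b) (by simp), ← ha φ (by simp), hψ]
    rw [← hmem, ← hmem, hcode, hcode, hp]
  have hX : #(Fin 1 → M) ≤ μ := by
    simpa using hM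
  have hD : #(Finset (Fin 1 → M) × Finset (Finset (Fin 1 → M))) ≤ μ := by
    rw [Cardinal.mk_prod, Cardinal.lift_id, Cardinal.lift_id]
    exact (mul_le_mul' (Cardinal.mk_finset_le hμ hX)
      (Cardinal.mk_finset_le hμ (Cardinal.mk_finset_le hμ hX))).trans (Cardinal.mul_eq_self hμ).le
  refine (Cardinal.mk_le_of_injective hinj).trans ?_
  rw [Cardinal.mk_arrow, Cardinal.lift_id, Cardinal.lift_id]
  refine (Cardinal.power_le_power_right hD).trans (Cardinal.power_le_power_left ?_
    (mk_formula_le _))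
  exact (Cardinal.aleph0_pos.trans_le hμ).ne'

theorem isStable_of_not_hasOrderFormula {T : L.Theory}
    (h : ∀ (M : Type (max u v)) [L.Structure M] [Nonempty M] [M ⊨ T], ¬ L.HasOrderFormula M) :
    IsStable T := by
  have h0 : ℵ₀ ≤ max ℵ₀ L.card := le_max_left _ _
  have h1 : max ℵ₀ L.card ≤ 2 ^ (max ℵ₀ L.card) := (Cardinal.cantor _).le
  refine ⟨2 ^ (max ℵ₀ L.card), h1, fun M _ _ _ hM => ?_⟩
  refine (mk_completeType_le_of_not_hasOrderFormula (h M) (h0.trans h1) hM).trans ?_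
  rw [← Cardinal.power_mul, Cardinal.mul_eq_self h0]

end GlobalTypes

/-! ### Realizing filters in ultrapowers -/

namespace GlobalTypes

variable {L : FirstOrder.Language.{u, v}}

/-- Every filter on assignments of the variables `α` in `N` is realized in an elementary extension
of `N`, namely in an ultrapower. -/
theorem exists_extension_realizing {N : Type w} [L.Structure N] [Nonempty N] {α J : Type w}
    (F : Filter J) [F.NeBot] (a : α → J → N) :
    ∃ (K : Type w) (_ : L.Structure K) (_ : Nonempty K) (f : N → K) (b : α → K),
      ∀ φ : L.Formula (N ⊕ α), (∀ᶠ j in F, φ.Realize (Sum.elim id fun s => a s j)) →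
        φ.Realize (Sum.elim f b) := by
  let U : Ultrafilter J := Ultrafilter.of F
  let g : N ⊕ α → J → N := Sum.elim (fun m _ => m) a
  refine ⟨(U : Filter J).Product fun _ => N, inferInstance, inferInstance,
    fun m => ((fun _ => m : J → N) : (U : Filter J).Product fun _ => N),
    fun s => (a s : (U : Filter J).Product fun _ => N), fun φ hφ => ?_⟩
  have h := (Ultraproduct.realize_formula_cast (u := U) (M := fun _ : J => N) φ g).2 (by
    filter_upwards [hφ.filter_mono (Ultrafilter.of_le F)] with j hj
    refine (iff_of_eq (congrArg _ ?_)).1 hj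
    ext (s | s) <;> rfl)
  refine (iff_of_eq (congrArg _ ?_)).1 h
  ext (s | s) <;> rfl

theorem model_of_extension {T : L.Theory} {N K : Type*} [L.Structure N] [L.Structure K]
    [N ⊨ T] {α : Type*} {f : N → K} {b : α → K}
    (h : ∀ φ : L.Formula (N ⊕ α), (∀ a, φ.Realize (Sum.elim id a)) → φ.Realize (Sum.elim f b)) :
    K ⊨ T := by
  refine ⟨fun θ hθ => ?_⟩
  have h1 := h (Formula.relabel (Empty.elim : Empty → N ⊕ α) θ) (fun a => by
    rw [Formula.realize_relabel]
    exact (iff_of_eq (congrArg (Formula.Realize θ) (Subsingleton.elim _ _))).1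
      (Theory.realize_sentence_of_mem (M := N) T hθ))
  rw [Formula.realize_relabel] at h1
  exact (iff_of_eq (congrArg (Formula.Realize θ) (Subsingleton.elim _ _))).1 h1

/-! ### Stability for types in several variables -/

/-- Two tuples have the same type over the set `A`. -/
def SameTypeOver {N : Type w} (L : FirstOrder.Language.{u, v}) [L.Structure N] (A : Set N)
    {α : Type*} (a b : α → N) : Prop :=
  ∀ φ : L.Formula (A ⊕ α), φ.Realize (Sum.elim (fun m : A => (m : N)) a) ↔
    φ.Realize (Sum.elim (fun m : A => (m : N)) b)

theorem exists_elementarySubstructure_le {N : Type (max u v)} [L.Structure N] {A : Set N}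
    {μ : Cardinal.{max u v}} (hμ : max ℵ₀ L.card ≤ μ) (hA : #A ≤ μ) :
    ∃ S : L.ElementarySubstructure N, A ⊆ S ∧ #S ≤ μ := by
  rcases le_total #N μ with h | h
  · exact ⟨⊤, fun _ _ => trivial, (Cardinal.mk_set_le (⊤ : Set N)).trans h⟩
  · obtain ⟨S, hS, hS'⟩ := exists_elementarySubstructure_card_eq L A μ
      ((le_max_left _ _).trans hμ) (by simpa using hA)
      (by simpa using (le_max_right _ _).trans hμ) (by simpa using h)
    refine ⟨S, hS, ?_⟩
    rw [Cardinal.lift_id, Cardinal.lift_id] at hS'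
    exact hS'.le

/-- The type over an elementary substructure of an element of the structure. -/
theorem exists_type_map {N : Type w} [L.Structure N] [Nonempty N]
    (S : L.ElementarySubstructure N) :
    ∃ t : N → (L.elementaryDiagram S).CompleteType (Fin 1), ∀ a b, t a = t b →
      SameTypeOver L (S : Set N) (fun _ : Fin 1 => a) (fun _ => b) := by
  let _ : (constantsOn S).Structure N := constantsOn.structure fun m : S => (m : N)
  have : N ⊨ L.elementaryDiagram S := by
    refine ⟨fun θ hθ => ?_⟩
    have h1 : S ⊨ θ := mem_completeTheory.1 hθ
    rw [← Formula.realize_equivSentence_symm_con (L := L)] at h1 ⊢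
    exact (S.subtype.map_formula (Formula.equivSentence.symm θ) _).2 h1
  refine ⟨fun a => (L.elementaryDiagram S).typeOf fun _ => a, fun a b hab φ => ?_⟩
  have h1 := SetLike.ext_iff.1 hab ((sentenceEquivFormula L S (Fin 1)).symm φ)
  rw [mem_typeOf_iff, mem_typeOf_iff, Equiv.apply_symm_apply] at h1
  exact h1

theorem mk_le_of_fibers {X Y : Type w} (f : X → Y) {μ : Cardinal.{w}} (hμ : ℵ₀ ≤ μ)
    (hY : #Y ≤ μ) (h : ∀ y, #{x // f x = y} ≤ μ) : #X ≤ μ := by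
  rw [← Cardinal.mk_congr (Equiv.sigmaFiberEquiv f), Cardinal.mk_sigma]
  refine (Cardinal.sum_le_sum _ (fun _ => μ) h).trans ?_
  rw [Cardinal.sum_const']
  exact (mul_le_mul_left hY μ).trans (Cardinal.mul_eq_self hμ).le

/-- If `e` and the first coordinate of `a` have the same type over `A`, then the type of `a` over `A`
is the limit of tuples with first coordinate `e`. A realization of the filter in an elementary
extension is a tuple of the type of `a` with first coordinate `e`. -/
theorem exists_filter_of_sameTypeOver {N : Type w} [L.Structure N] {A : Set N} {n : ℕ}
    {a : Fin (n + 1) → N} {e : N} (h : SameTypeOver L A (fun _ : Fin 1 => a 0) fun _ => e) :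
    ∃ F : Filter (Fin (n + 1) → N), F.NeBot ∧ (∀ᶠ w in F, w 0 = e) ∧
      ∀ φ : L.Formula (A ⊕ Fin (n + 1)),
        φ.Realize (Sum.elim (fun m : A => (m : N)) a) →
        ∀ᶠ w in F, φ.Realize (Sum.elim (fun m : A => (m : N)) w) := by
  let s : {φ : L.Formula (A ⊕ Fin (n + 1)) // φ.Realize (Sum.elim (fun m : A => (m : N)) a)} →
      Set (Fin (n + 1) → N) := fun φ =>
    {w | w 0 = e ∧ φ.1.Realize (Sum.elim (fun m : A => (m : N)) w)}
  have hne : Nonempty {φ : L.Formula (A ⊕ Fin (n + 1)) //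
      φ.Realize (Sum.elim (fun m : A => (m : N)) a)} := ⟨⟨⊤, by simp⟩⟩
  refine ⟨⨅ φ, Filter.principal (s φ), Filter.iInf_principal_neBot s ?_ ?_, ?_, fun φ hφ => ?_⟩
  · rintro ⟨φ, hφ⟩
    let χ : L.Formula (A ⊕ Fin 1) := Formula.iExs (Fin (n + 1))
      (φ.relabel (Sum.map Sum.inl id) ⊓
        Term.equal (Term.var (Sum.inr 0)) (Term.var (Sum.inl (Sum.inr 0))))
    have hχ : ∀ b : N, χ.Realize (Sum.elim (fun m : A => (m : N)) fun _ => b) ↔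
        ∃ w : Fin (n + 1) → N, w 0 = b ∧ φ.Realize (Sum.elim (fun m : A => (m : N)) w) := by
      intro b
      rw [Formula.realize_iExs]
      refine exists_congr fun w => ?_
      rw [Formula.realize_inf, Formula.realize_relabel, Formula.realize_equal, and_comm]
      refine and_congr Iff.rfl (iff_of_eq (congrArg _ ?_))
      ext (m | k) <;> rfl
    exact (hχ e).1 ((h χ).1 ((hχ (a 0)).2 ⟨a, rfl, hφ⟩))
  · rintro ⟨φ, hφ⟩ ⟨ψ, hψ⟩
    exact ⟨⟨φ ⊓ ψ, Formula.realize_inf.2 ⟨hφ, hψ⟩⟩,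
      fun w hw => ⟨hw.1, (Formula.realize_inf.1 hw.2).1⟩,
      fun w hw => ⟨hw.1, (Formula.realize_inf.1 hw.2).2⟩⟩
  · exact (Filter.eventually_mem_iInf_principal s hne.some).mono fun w hw => hw.1
  · exact (Filter.eventually_mem_iInf_principal s ⟨φ, hφ⟩).mono fun w hw => hw.2

/-- If there are at most `μ` one-types over models of size `μ`, the same holds for `n`-types: among
tuples whose first coordinates have the same type `tp(e)`, the first coordinates may be assumed to
be equal to `e` in an elementary extension, and `e` becomes a parameter. -/
theorem IsStableIn.mk_le {T : L.Theory} {μ : Cardinal.{max u v}} (hT : IsStableIn T μ)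
    (hμ : max ℵ₀ L.card ≤ μ) (n : ℕ) : ∀ (N : Type (max u v)) [L.Structure N] [Nonempty N] [N ⊨ T]
    (A : Set N), #A ≤ μ → ∀ (I : Type (max u v)) (a : I → Fin n → N),
      (∀ i j, SameTypeOver L A (a i) (a j) → i = j) → #I ≤ μ := by
  have hμ0 : ℵ₀ ≤ μ := (le_max_left _ _).trans hμ
  induction n with
  | zero =>
    intro N _ _ _ A _ I a ha
    have : Subsingleton I := ⟨fun i j => ha i j fun φ => by rw [Subsingleton.elim (a i) (a j)]⟩
    exact (Cardinal.le_one_iff_subsingleton.2 this).trans (Cardinal.one_le_aleph0.trans hμ0)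
  | succ n ih =>
    intro N _ _ _ A hA I a ha
    obtain ⟨S, hAS, hS⟩ := exists_elementarySubstructure_le hμ hA
    obtain ⟨t, ht⟩ := exists_type_map S
    refine mk_le_of_fibers (fun i => t (a i 0)) hμ0 (hT S hS) fun y => ?_
    let I' := {i // t (a i 0) = y}
    change #I' ≤ μ
    rcases isEmpty_or_nonempty I' with hI' | ⟨⟨i₀⟩⟩
    · simp
    let e := a i₀.1 0
    have hF := fun i : I' => exists_filter_of_sameTypeOver (n := n) (a := a i.1) (e := e)
      (ht (a i.1 0) e (i.2.trans i₀.2.symm))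
    choose F hFne hFe hF using hF
    obtain ⟨K, _, _, f, b, hb⟩ := exists_extension_realizing (L := L) (N := N) (Filter.pi F)
      fun (s : I' × ULift.{max u v} (Fin (n + 1))) w => w s.1 s.2.down
    have : K ⊨ T := model_of_extension (α := I' × ULift.{max u v} (Fin (n + 1)))
      fun φ hφ => hb φ (Filter.Eventually.of_forall fun _ => hφ _)
    let c : I' → Fin (n + 1) → K := fun i k => b (i, ⟨k⟩)
    have hc0 : ∀ i, c i 0 = f e := by
      intro i
      have h := hb (Term.equal (Term.var (Sum.inr (i, ⟨0⟩))) (Term.var (Sum.inl e))) (by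
        filter_upwards [(Filter.tendsto_eval_pi F i).eventually (hFe i)] with w hw
        exact Formula.realize_equal.2 hw)
      exact Formula.realize_equal.1 h
    have hcφ : ∀ i (φ : L.Formula ((S : Set N) ⊕ Fin (n + 1))),
        φ.Realize (Sum.elim (fun m : (S : Set N) => (m : N)) (a i.1)) →
        φ.Realize (Sum.elim (fun m : (S : Set N) => f m) (c i)) := by
      intro i φ hφ
      have h := hb (φ.relabel (Sum.map (fun m : (S : Set N) => (m : N)) fun k => (i, ⟨k⟩))) (by
        filter_upwards [(Filter.tendsto_eval_pi F i).eventually (hF i φ hφ)] with w hw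
        rw [Formula.realize_relabel]
        refine (iff_of_eq (congrArg _ ?_)).1 hw
        ext (m | k) <;> rfl)
      rw [Formula.realize_relabel] at h
      refine (iff_of_eq (congrArg _ ?_)).1 h
      ext (m | k) <;> rfl
    have hcφ' : ∀ i (φ : L.Formula ((S : Set N) ⊕ Fin (n + 1))),
        φ.Realize (Sum.elim (fun m : (S : Set N) => (m : N)) (a i.1)) ↔
        φ.Realize (Sum.elim (fun m : (S : Set N) => f m) (c i)) := fun i φ =>
      ⟨hcφ i φ, fun h => by_contra fun h' => hcφ i φ.not h' h⟩
    let A' : Set K := insert (f e) (f '' (S : Set N))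
    have hA' : #A' ≤ μ := by
      refine (Cardinal.mk_insert_le).trans ?_
      refine (add_le_add (Cardinal.mk_image_le.trans hS) (Cardinal.one_le_aleph0.trans hμ0)).trans ?_
      exact (Cardinal.add_eq_self hμ0).le
    refine ih K A' hA' I' (fun i k => c i k.succ) fun i j hij => ?_
    refine Subtype.ext (ha i.1 j.1 fun φ => ?_)
    let φ' : L.Formula ((S : Set N) ⊕ Fin (n + 1)) := φ.relabel (Sum.map (Set.inclusion hAS) id)
    have hφ' : ∀ w : Fin (n + 1) → N,
        φ'.Realize (Sum.elim (fun m : (S : Set N) => (m : N)) w) ↔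
        φ.Realize (Sum.elim (fun m : A => (m : N)) w) := by
      intro w
      rw [Formula.realize_relabel]
      refine iff_of_eq (congrArg _ ?_)
      ext (m | k) <;> rfl
    let g : (S : Set N) ⊕ Fin (n + 1) → A' ⊕ Fin n :=
      Sum.elim (fun m => Sum.inl ⟨f m, Or.inr ⟨m, m.2, rfl⟩⟩)
        (Fin.cases (Sum.inl ⟨f e, Or.inl rfl⟩) Sum.inr)
    have hg : ∀ i, (φ'.relabel g).Realize
        (Sum.elim (fun m : A' => (m : K)) fun k : Fin n => c i k.succ) ↔
        φ.Realize (Sum.elim (fun m : A => (m : N)) (a i.1)) := by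
      intro i
      rw [← hφ', hcφ']
      refine Formula.realize_relabel.trans (iff_of_eq (congrArg _ ?_))
      ext (m | k)
      · rfl
      · refine Fin.cases ?_ (fun k => ?_) k
        · exact (hc0 i).symm
        · rfl
    rw [← hg, ← hg]
    exact hij _

end GlobalTypes

/-! ### The order property yields many types -/

/-- For every infinite `μ` there is a linear order with more than `μ` elements and a subset of size
at most `μ` that separates its points: the binary sequences of length `ν`, ordered
lexicographically, where `ν` is least with `μ < 2 ^ ν`, and among them those that have a last
nonzero entry. -/
theorem exists_linearOrder_separated {μ : Cardinal.{w}} (hμ : ℵ₀ ≤ μ) :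
    ∃ (I : Type w) (_ : LinearOrder I) (J : Set I), μ < #I ∧ #J ≤ μ ∧
      ∀ x y : I, x < y → ∃ z ∈ J, x < z ∧ z ≤ y := by
  classical
  have hex : ∃ ν : Cardinal.{w}, μ < 2 ^ ν := ⟨μ, Cardinal.cantor μ⟩
  let ν := sInf {ν : Cardinal.{w} | μ < 2 ^ ν}
  have hν : μ < 2 ^ ν := csInf_mem (s := {ν : Cardinal.{w} | μ < 2 ^ ν}) hex
  have hνμ : ν ≤ μ := csInf_le' (Cardinal.cantor μ)
  have hlt : ∀ ν' < ν, 2 ^ ν' ≤ μ := fun ν' h => not_lt.1 fun h' => notMem_of_lt_csInf' (s := {ν : Cardinal.{w} | μ < 2 ^ ν}) h h'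
  let W := ν.ord.ToType
  have hW : #W = ν := by simp [W]
  let z : (Σ i : W, (Set.Iio i → Bool)) → Lex (W → Bool) := fun s => toLex fun j =>
    if h : j < s.1 then s.2 ⟨j, h⟩ else decide (j = s.1)
  refine ⟨Lex (W → Bool), inferInstance, Set.range z, ?_, ?_, fun x y hxy => ?_⟩
  · have : #(Lex (W → Bool)) = 2 ^ ν := by
      change #(W → Bool) = 2 ^ ν
      simp [hW]
    rwa [this]
  · refine Cardinal.mk_range_le.trans ?_
    rw [Cardinal.mk_sigma]
    refine (Cardinal.sum_le_sum _ (fun _ => μ) fun i => ?_).trans ?_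
    · have hi : #(Set.Iio i) < ν := by
        have := Cardinal.mk_Iio_lt i (by rw [hW]; simp [W])
        rwa [hW] at this
      simpa using hlt _ hi
    · rw [Cardinal.sum_const', hW]
      exact (mul_le_mul_left hνμ μ).trans (Cardinal.mul_eq_self hμ).le
  · obtain ⟨i, hi, hxi⟩ := hxy
    have hxi' : x i = false ∧ y i = true := by
      revert hxi
      cases x i <;> cases y i <;> simp
    let s : Σ i : W, (Set.Iio i → Bool) := ⟨i, fun j => x j⟩
    have hz1 : ∀ j < i, z s j = x j := fun j hj => by
      change (if h : j < i then x j else decide (j = i)) = x j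
      simp [hj]
    have hz2 : z s i = true := by
      change (if h : i < i then x i else decide (i = i)) = true
      simp
    have hz3 : ∀ j, i < j → z s j = false := fun j hj => by
      change (if h : j < i then x j else decide (j = i)) = false
      simp [hj.not_gt, hj.ne']
    refine ⟨z s, ⟨s, rfl⟩, ⟨i, fun j hj => (hz1 j hj).symm, ?_⟩, ?_⟩
    · change x i < z s i
      rw [hxi'.1, hz2]
      decide
    · refine not_lt.1 ?_
      rintro ⟨j, hj, hyj⟩
      change y j < z s j at hyj
      rcases lt_trichotomy j i with h | rfl | h
      · rw [hz1 j h] at hyj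
        exact hyj.ne (hi j h).symm
      · rw [hz2, hxi'.2] at hyj
        exact hyj.ne rfl
      · rw [hz3 j h] at hyj
        exact not_lt_bot hyj

namespace GlobalTypes

variable {L : FirstOrder.Language.{u, v}}

/-- By compactness, a formula with the order property orders sequences indexed by any linear order,
in some model. -/
theorem exists_ordered_family {T : L.Theory} {N : Type w} [L.Structure N]
    [Nonempty N] [N ⊨ T] {n : ℕ} {φ : L.Formula (Fin n ⊕ Fin n)}
    (h : HasOrderProperty fun a b : Fin n → N => φ.Realize (Sum.elim a b))
    (I : Type w) [LinearOrder I] :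
    ∃ (K : Type w) (_ : L.Structure K) (_ : Nonempty K) (_ : K ⊨ T) (a b : I → Fin n → K),
      ∀ i j, φ.Realize (Sum.elim (a i) (b j)) ↔ i < j := by
  classical
  let s : Finset I → Set (I → Fin n ⊕ Fin n → N) := fun S => {d | ∀ i ∈ S, ∀ j ∈ S,
    (φ.Realize (Sum.elim (fun k => d i (Sum.inl k)) fun k => d j (Sum.inr k)) ↔ i < j)}
  have : (⨅ S, Filter.principal (s S)).NeBot := by
    refine Filter.iInf_principal_neBot s (fun S => ?_) fun S S' => ⟨S ∪ S', ?_, ?_⟩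
    · obtain ⟨a, b, hab⟩ := h S.card
      let e := S.orderIsoOfFin rfl
      let r : I → ℕ := fun i => if hi : i ∈ S then e.symm ⟨i, hi⟩ else 0
      refine ⟨fun i => Sum.elim (a (r i)) (b (r i)), fun i hi j hj => ?_⟩
      have hr : ∀ i, i ∈ S → r i < S.card := fun i hi => by simp [r, hi]
      refine (hab _ (hr i hi) _ (hr j hj)).trans ?_
      simp only [r, hi, hj, dif_pos, Fin.val_fin_lt, OrderIso.lt_iff_lt, Subtype.mk_lt_mk]
    · exact fun d hd i hi j hj => hd i (Finset.mem_union_left _ hi) j (Finset.mem_union_left _ hj)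
    · exact fun d hd i hi j hj => hd i (Finset.mem_union_right _ hi) j (Finset.mem_union_right _ hj)
  obtain ⟨K, _, _, f, b, hb⟩ := exists_extension_realizing (L := L) (N := N)
    ((⨅ S, Filter.principal (s S)).map fun d (t : I × ULift.{w} (Fin n ⊕ Fin n)) => d t.1 t.2.down)
    fun t d => d t
  have hK : K ⊨ T := model_of_extension (N := N) (α := I × ULift.{w} (Fin n ⊕ Fin n))
    fun φ hφ => hb φ (Filter.Eventually.of_forall fun _ => hφ _)
  refine ⟨K, inferInstance, inferInstance, hK, fun i k => b (i, ⟨Sum.inl k⟩),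
    fun i k => b (i, ⟨Sum.inr k⟩), fun i j => ?_⟩
  let ψ : L.Formula (N ⊕ I × ULift.{w} (Fin n ⊕ Fin n)) := φ.relabel
    (Sum.elim (fun k => Sum.inr (i, ⟨Sum.inl k⟩)) fun k => Sum.inr (j, ⟨Sum.inr k⟩))
  have hψN : ∀ a : I × ULift.{w} (Fin n ⊕ Fin n) → N, ψ.Realize (Sum.elim id a) ↔
      φ.Realize (Sum.elim (fun k => a (i, ⟨Sum.inl k⟩)) fun k => a (j, ⟨Sum.inr k⟩)) := by
    intro a
    refine Formula.realize_relabel.trans (iff_of_eq (congrArg _ ?_))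
    ext (k | k) <;> rfl
  have hψK : ψ.Realize (Sum.elim f b) ↔
      φ.Realize (Sum.elim (fun k => b (i, ⟨Sum.inl k⟩)) fun k => b (j, ⟨Sum.inr k⟩)) := by
    refine Formula.realize_relabel.trans (iff_of_eq (congrArg _ ?_))
    ext (k | k) <;> rfl
  rw [← hψK]
  have hev : ∀ᶠ d in ⨅ S, Filter.principal (s S),
      (ψ.Realize (Sum.elim id fun t => d t.1 t.2.down) ↔ i < j) := by
    filter_upwards [Filter.eventually_mem_iInf_principal s {i, j}] with d hd
    rw [hψN]
    exact hd i (by simp) j (by simp)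
  by_cases hij : i < j
  · exact iff_of_true (hb ψ (Filter.eventually_map.2 (hev.mono fun d h => h.2 hij))) hij
  · refine iff_of_false (hb ψ.not (Filter.eventually_map.2 (hev.mono fun d h => ?_))) hij
    exact fun h' => hij (h.1 h')

theorem not_isStable_of_hasOrderFormula {T : L.Theory} {N : Type (max u v)} [L.Structure N]
    [Nonempty N] [N ⊨ T] (h : L.HasOrderFormula N) : ¬ IsStable T := by
  rintro ⟨μ, hμ, hT⟩
  have hμ0 : ℵ₀ ≤ μ := (le_max_left _ _).trans hμ
  obtain ⟨n, φ, h⟩ := h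
  obtain ⟨I, _, J, hI, hJ, hsep⟩ := exists_linearOrder_separated hμ0
  obtain ⟨K, _, _, _, a, b, hab⟩ := exists_ordered_family (T := T) h I
  let A : Set K := ⋃ z : J, Set.range (b z)
  have hA : #A ≤ μ := by
    refine Cardinal.mk_iUnion_le_sum_mk.trans ((Cardinal.sum_le_sum _ (fun _ => ℵ₀) fun z =>
      (Set.countable_range _).le_aleph0).trans ?_)
    rw [Cardinal.sum_const']
    exact (mul_le_mul' hJ hμ0).trans (Cardinal.mul_eq_self hμ0).le
  have hlt : ∀ x y, x < y → ¬ SameTypeOver L A (a x) (a y) := by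
    intro x y hxy hsame
    obtain ⟨z, hz, hxz, hzy⟩ := hsep x y hxy
    let ψ : L.Formula (A ⊕ Fin n) := φ.relabel (Sum.elim Sum.inr
      fun k => Sum.inl ⟨b z k, Set.mem_iUnion.2 ⟨⟨z, hz⟩, k, rfl⟩⟩)
    have hψ : ∀ x, ψ.Realize (Sum.elim (fun m : A => (m : K)) (a x)) ↔ x < z := by
      intro x
      rw [← hab]
      refine Formula.realize_relabel.trans (iff_of_eq (congrArg _ ?_))
      ext (k | k) <;> rfl
    have := hsame ψ
    rw [hψ, hψ] at this
    exact hzy.not_gt (this.1 hxz)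
  refine (hT.mk_le hμ n K A hA I a fun x y hxy => ?_).not_gt hI
  rcases lt_trichotomy x y with h | h | h
  · exact absurd hxy (hlt x y h)
  · exact h
  · exact absurd (fun φ => (hxy φ).symm) (hlt y x h)

end GlobalTypes

theorem mainTheorem11 {L : FirstOrder.Language.{u, v}} (T : L.Theory) (hT : T.IsComplete)
    (C : Type w) [L.Structure C] [Nonempty C] [C ⊨ T]
    (κ : Cardinal.{w}) (hC : GlobalTypes.IsMonster L C κ)
    {ι : Type x} (c : ι → C) (hc : Function.Surjective c) :
    (∃ op : GlobalTypes.typeSpace L c → GlobalTypes.typeSpace L c → GlobalTypes.typeSpace L c,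
        (∀ p q r, op (op p q) r = op p (op q r)) ∧
        (∀ q, Continuous fun p => op p q) ∧
        (∀ (σ : C ≃[L] C) (q : GlobalTypes.typeSpace L c),
          op (GlobalTypes.autType c σ) q = GlobalTypes.autActOn c σ q)) ↔
      GlobalTypes.IsStable T := by
  have hκ : ℵ₀ < κ := by
    have h := (Cardinal.lift_le.{w}.2 (le_max_left ℵ₀ L.card)).trans_lt hC.card_lt
    simpa using h
  constructor
  · rintro ⟨op, -, hcont, hact⟩
    refine GlobalTypes.isStable_of_not_hasOrderFormula fun M _ _ _ hM => ?_
    exact GlobalTypes.not_hasOrderFormula_of_operation hC.saturated hC.homogeneous hκ hc op hcont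
      hact (hM.of_isComplete hT)
  · intro hst
    refine GlobalTypes.exists_semigroup_operation hC.saturated hC.homogeneous hκ.le
      (fun hord => ?_) hc
    obtain ⟨N⟩ := hT.1
    let _ : L.Structure N := N.struc
    exact GlobalTypes.not_isStable_of_hasOrderFormula (hord.of_isComplete hT (N := N)) hst
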